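/- For $z\in\mathbb{H}=\{z\in\mathbb{C}:\operatorname{Im} z>0\}$ put $q=e^{2\pi i z}$, and let $$G_2(z)=-\frac1{24}+\sum_{n\ge1}\sigma_1(n)q^n,\qquad \theta(z)=\sum_{n\in\mathbb{Z}}q^{n^2},\qquad f_m(z)=G_2(mz)\theta(z)+\frac{1}{2m\pi i}\theta'(z)\quad(m=4,8),$$ where $\sigma_1(n)$ is the sum of the positive divisors of $n$. Let $\mathbf{M}_{5/2}(\Gamma_0(64))$ be the space of holomorphic functions $f:\mathbb{H}\to\mathbb{C}$ that are holomorphic at all cusps and satisfy $$f\Big(\frac{az+b}{cz+d}\Big)=\Big(\frac cd\Big)\Big(\frac{-4}{d}\Big)^{-5/2}(cz+d)^{5/2}f(z)$$ for all $z\in\mathbb{H}$ and $\begin{pmatrix}a&b\\c&d\end{pmatrix}\in\Gamma_0(64)$, with Kronecker symbols and principal branches of the powers. (Here $\big(\frac{c}{-1}\big)=-1$ if $c<0$ and $\big(\frac{c}{-1}\big)=1$ if $c\ge0$. Holomorphic at all cusps means that for every $\begin{pmatrix}a&b\\c&d\end{pmatrix}\in \mathrm{SL}(2,\mathbb{Z})$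 the function $(cz+d)^{-5/2}f\big(\frac{az+b}{cz+d}\big)$ is bounded as $\operatorname{Im} z\to\infty$.) The functions $f_4$ and $f_8$ have Fourier expansions $f_m(z)=\sum_{n\ge0}a_m(n)q^n$ converging on $\mathbb{H}$. Define $$h(z)=\sum_{n\equiv1\,[8],\ n>0}a_8(n)q^n,\qquad g(z)=\sum_{n\equiv1\,[8],\ n>0}a_4(n)q^n .$$ Then $g$ and $h$ belong to $\mathbf{M}_{5/2}(\Gamma_0(64))$, and $$h=\frac25\,g .$$ Consequently $a_8(n)=\frac25\,a_4(n)$ for all $n>0$ with $n\equiv1 \pmod 8$. -/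

import Mathlib

open UpperHalfPlane

noncomputable section

namespace HalfIntegralWeight

/-- The Kronecker symbol `(a / b)`. For `b ≠ 0` write `b = ± 2 ^ v * m` with `m > 0` odd; then
`(a / b) = (a / ±1) * (a / 2) ^ v * (a / m)`, where `(a / -1)` is `-1` for `a < 0` and `1` for
`a ≥ 0`, `(a / 2)` is `(-1) ^ ((a ^ 2 - 1) / 8)` for odd `a` and `0` for even `a`, and `(a / m)` is
the Jacobi symbol. -/
def kronecker (a b : ℤ) : ℤ :=
  if b = 0 then (if a.natAbs = 1 then 1 else 0)
  else (if b < 0 ∧ a < 0 then -1 else 1) * ZMod.χ₈ (a : ZMod 8) ^ (b.natAbs.factorization 2) *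
    jacobiSym a (b.natAbs / 2 ^ (b.natAbs.factorization 2))

/-- `c z + d` for `γ = (a b; c d)`. -/
def cocycle (γ : Matrix.SpecialLinearGroup (Fin 2) ℤ) (τ : ℍ) : ℂ :=
  (γ 1 0 : ℂ) * (τ : ℂ) + (γ 1 1 : ℂ)

/-- The automorphy factor of weight `k = κ / 2`: it is `(c z + d) ^ k` for integral `k`, and
`(c / d) * (-4 / d) ^ (-k) * (c z + d) ^ k` for `k ∈ 1/2 + ℤ`, with Kronecker symbols and principal
branches of the powers. -/
def factor (κ : ℤ) (γ : Matrix.SpecialLinearGroup (Fin 2) ℤ) (τ : ℍ) : ℂ :=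
  if Even κ then cocycle γ τ ^ (κ / 2)
  else (kronecker (γ 1 0) (γ 1 1) : ℂ) *
    (kronecker (-4) (γ 1 1) : ℂ) ^ (-((κ : ℂ) / 2)) * cocycle γ τ ^ ((κ : ℂ) / 2)

/-- The space of modular forms of weight `κ / 2` for `Γ₀(N)` (with `4 ∣ N` when `κ` is odd).
Holomorphy at the cusps is required at every cusp `ξ ∞`, `ξ ∈ SL(2, ℤ)`, as boundedness of
`(c z + d) ^ (-κ / 2) * f (ξ z)` when `Im z → ∞`. -/
def modularForms (κ : ℤ) (N : ℕ) : Submodule ℂ (ℍ → ℂ) where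
  carrier := {f |
    MDifferentiable (modelWithCornersSelf ℂ ℂ) (modelWithCornersSelf ℂ ℂ) f ∧
    (∀ γ ∈ CongruenceSubgroup.Gamma0 N, ∀ τ : ℍ, f (γ • τ) = factor κ γ τ * f τ) ∧
    (∀ ξ : Matrix.SpecialLinearGroup (Fin 2) ℤ,
      IsBoundedAtImInfty fun τ : ℍ => cocycle ξ τ ^ (-((κ : ℂ) / 2)) * f (ξ • τ))}
  zero_mem' := by
    refine ⟨mdifferentiable_const, by simp, fun ξ => ?_⟩
    simpa [Pi.zero_def] using! (zero_form_isBoundedAtImInfty (α := ℂ))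
  add_mem' := by
    rintro f g ⟨hf, hf', hf''⟩ ⟨hg, hg', hg''⟩
    refine ⟨hf.add hg, fun γ hγ τ => ?_, fun ξ => ?_⟩
    · simp only [Pi.add_apply, hf' γ hγ τ, hg' γ hγ τ, mul_add]
    · simp only [Pi.add_apply, mul_add]
      exact Filter.BoundedAtFilter.add (hf'' ξ) (hg'' ξ)
  smul_mem' := by
    rintro r f ⟨hf, hf', hf''⟩
    refine ⟨hf.const_smul r, fun γ hγ τ => ?_, fun ξ => ?_⟩
    · simp only [Pi.smul_apply, hf' γ hγ τ, smul_eq_mul]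
      ring
    · simp only [Pi.smul_apply, smul_eq_mul, mul_left_comm _ r]
      exact Filter.BoundedAtFilter.smul r (hf'' ξ)

/-- `q = exp (2 π i z)`. -/
def q (z : ℂ) : ℂ := Complex.exp (2 * Real.pi * Complex.I * z)

/-- `G₂(z) = -1/24 + ∑_{n ≥ 1} σ₁(n) qⁿ`. -/
def G₂ (z : ℂ) : ℂ := -1 / 24 + ∑' n : ℕ+, (ArithmeticFunction.sigma 1 (n : ℕ) : ℂ) * q z ^ (n : ℕ)

/-- `θ(z) = ∑_{n ∈ ℤ} q^{n²}`. -/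
def θ (z : ℂ) : ℂ := ∑' n : ℤ, q z ^ (n ^ 2)

/-- `f_m(z) = G₂(m z) θ(z) + (1 / (2 m π i)) θ'(z)`. -/
def f (m : ℕ) (τ : ℍ) : ℂ :=
  G₂ (m * (τ : ℂ)) * θ τ + 1 / (2 * m * Real.pi * Complex.I) * deriv θ τ

/-- `a_m(n)`, the `n`-th Fourier coefficient (coefficient of `qⁿ`) of `f_m`. -/
def a (m n : ℕ) : ℂ := (qExpansion 1 (f m)).coeff n

/-- `h = ∑_{n ≡ 1 [8]} a_8(n) qⁿ`. -/
def h (τ : ℍ) : ℂ := ∑' n : {n : ℕ // n ≡ 1 [MOD 8]}, a 8 n * q τ ^ (n : ℕ)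

/-- `g = ∑_{n ≡ 1 [8]} a_4(n) qⁿ`. -/
def g (τ : ℍ) : ℂ := ∑' n : {n : ℕ // n ≡ 1 [MOD 8]}, a 4 n * q τ ^ (n : ℕ)

end HalfIntegralWeight

end

/-!
Write `D = q d/dq` and let `ϑ = θ(z) - θ(4 z)` be the theta series `∑ q^{s²}` over odd `s`. In
the product expansion of `f_m` the exponents are `m k + s²`, and for `m = 4, 8` such an exponent
is `1` modulo `8` only if `s` is odd and `m k` is divisible by `8`. Hence `h = G₂(8 z) ϑ +
D ϑ / 8`, and `g` is the same expression with `D ϑ / 4` and with the even part of `G₂(4 z)`, which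
equals `3 G₂(8 z) - 2 G₂(16 z)` because `σ₁(2 n) = 3 σ₁(n) - 2 σ₁(n / 2)`.

By Gauss' identity for triangular numbers `ϑ = 2 η(16 z)² / η(8 z)` (`thetaOdd_mul_eta`), so
logarithmic differentiation gives `D ϑ / ϑ = 8 G₂(8 z) - 32 G₂(16 z)` (`deriv_thetaOdd`), whence
`g = 5 F ϑ` and `h = 2 F ϑ` with `F = G₂(8 z) - 2 G₂(16 z)` (`g_eq`, `h_eq`). This proves
`h = 2/5 g`, and it remains to see that `F ϑ` is a modular form (`eisTheta_mem`).

* `F` has weight `2` for `Γ₀(16)`, since the non-modular terms in the transformation law of `E₂`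
  cancel (`eisTwo_smul`).
* `θ` transforms with the factor of weight `1/2` under `Γ₀(4)` (`thetaLaw_of_four_dvd`): the law is
  checked on `T`, `-1` and `(1 0; 4 1)`, and the Euclidean algorithm on the lower row of a matrix
  reduces the general case to these. Conjugation gives `θ(4 z)`, hence `ϑ`, on `Γ₀(16)`.
* For the cusps, `|E₂ - 3 / (π Im)| · Im` and `(|θ₂| + |θ₃| + |θ₄|) · Im ^ (1/4)`, with the
  three even theta null values, are invariant under `SL(2, ℤ)`. A function `u · Im ^ k` of this
  kind with `u` bounded at `i∞` controls the growth of `τ ↦ u (N τ)` at every cusp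
  (`isBigO_of_invariant`).
-/

noncomputable section

namespace HalfIntegralWeight

/-! ### The Kronecker symbol in its lower argument -/

lemma kronecker_of_odd (c : ℤ) {d : ℤ} (hd : Odd d) :
    kronecker c d = (if d < 0 ∧ c < 0 then -1 else 1) * jacobiSym c d.natAbs := by
  have h0 : d ≠ 0 := by rintro rfl; simp at hd
  have h2 : ¬ 2 ∣ d.natAbs := by
    have := Int.natAbs_odd.mpr hd
    grind
  rw [kronecker, if_neg h0, Nat.factorization_eq_zero_of_not_dvd h2]
  simp

lemma jacobiSym_four_mul (e : ℤ) {b : ℕ} (hb : Odd b) : jacobiSym (4 * e) b = jacobiSym e b := by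
  rw [jacobiSym.mul_left, jacobiSym.at_four hb, one_mul]

lemma χ₄_of_four_dvd_add {m n : ℕ} (h : 4 ∣ m + n) :
    ZMod.χ₄ (m : ZMod 4) = -ZMod.χ₄ (n : ZMod 4) := by
  have h1 : ((m + n : ℕ) : ZMod 4) = 0 := (ZMod.natCast_eq_zero_iff _ _).mpr h
  push_cast at h1
  have h2 : (m : ZMod 4) = -(n : ZMod 4) := eq_neg_of_add_eq_zero_left h1
  rw [h2]
  generalize (n : ZMod 4) = x
  revert x; decide

lemma χ₈_of_eight_dvd_add {m n : ℕ} (h : 8 ∣ m + n) :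
    ZMod.χ₈ (m : ZMod 8) = ZMod.χ₈ (n : ZMod 8) := by
  have h1 : ((m + n : ℕ) : ZMod 8) = 0 := (ZMod.natCast_eq_zero_iff _ _).mpr h
  push_cast at h1
  have h2 : (m : ZMod 8) = -(n : ZMod 8) := eq_neg_of_add_eq_zero_left h1
  rw [h2]
  generalize (n : ZMod 8) = x
  revert x; decide

/-- For positive `u` the symbol `(u / b)` depends only on `±b` modulo `4 u`; this is the case of
opposite signs for odd `u`. -/
lemma jacobiSym_odd_of_dvd_add {u m n : ℕ} (hu : Odd u) (hm : Odd m) (hn : Odd n)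
    (h4 : 4 ∣ m + n) (h : u ∣ m + n) : jacobiSym u m = jacobiSym u n := by
  rw [jacobiSym.quadratic_reciprocity' hu hm, jacobiSym.quadratic_reciprocity' hu hn]
  have e1 : jacobiSym (m : ℤ) u = ZMod.χ₄ u * jacobiSym (n : ℤ) u := by
    rw [← jacobiSym.neg _ hu]
    apply jacobiSym.mod_left'
    refine (Int.modEq_iff_dvd.mpr ?_).symm
    simpa using (by exact_mod_cast h : (u : ℤ) ∣ (m : ℤ) + n)
  have e2 : qrSign m u = ZMod.χ₄ u * qrSign n u := by
    unfold qrSign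
    rw [χ₄_of_four_dvd_add h4, jacobiSym.neg _ hu]
  have e3 : ZMod.χ₄ (u : ZMod 4) * ZMod.χ₄ (u : ZMod 4) = 1 := by
    rw [← jacobiSym.at_neg_one hu]
    have := jacobiSym.sq_one (a := -1) (b := u) (by simp)
    rwa [sq] at this
  rw [e1, e2]
  calc _ = (ZMod.χ₄ (u : ZMod 4) * ZMod.χ₄ (u : ZMod 4)) * (qrSign n u * jacobiSym n u) := by ring
    _ = _ := by rw [e3, one_mul]

lemma jacobiSym_nat_of_dvd_add {e m n : ℕ} (hm : Odd m) (hn : Odd n)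
    (h : 4 * e ∣ m + n) : jacobiSym e m = jacobiSym e n := by
  rcases Nat.eq_zero_or_pos e with rfl | he
  · simp at h
    obtain ⟨rfl, rfl⟩ := h
    rfl
  obtain ⟨k, u, hu, rfl⟩ := Nat.exists_eq_two_pow_mul_odd he.ne'
  push_cast
  rw [jacobiSym.mul_left, jacobiSym.mul_left, jacobiSym.pow_left, jacobiSym.pow_left]
  congr 1
  · rcases Nat.eq_zero_or_pos k with rfl | hk
    · simp
    · rw [jacobiSym.at_two hm, jacobiSym.at_two hn, χ₈_of_eight_dvd_add]
      refine dvd_trans ?_ h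
      obtain ⟨j, rfl⟩ := Nat.exists_eq_add_of_lt hk
      exact ⟨2 ^ j * u, by ring⟩
  · exact jacobiSym_odd_of_dvd_add hu hm hn (dvd_trans (Dvd.intro _ rfl) h)
      (dvd_trans ⟨4 * 2 ^ k, by ring⟩ h)

lemma jacobiSym_eq_of_dvd_sub {c : ℤ} (hc : 4 ∣ c) {m n : ℕ} (hm : Odd m) (hn : Odd n)
    (h : c ∣ (m : ℤ) - n) : jacobiSym c m = jacobiSym c n := by
  obtain ⟨e, rfl⟩ := hc
  rw [jacobiSym_four_mul _ hm, jacobiSym_four_mul _ hn, jacobiSym.mod_right _ hm,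
    jacobiSym.mod_right _ hn]
  congr 1
  have h' : ((4 * e.natAbs : ℕ) : ℤ) ∣ (m : ℤ) - n := by
    push_cast
    rcases abs_choice e with he | he <;> rw [he]
    · exact h
    · rw [mul_neg]; exact (neg_dvd).mpr h
  exact ((Nat.modEq_iff_dvd).mpr h').symm

/-- Periodicity of `(c / b)` in `b` across a change of sign: `b ↦ -b` costs the sign of `c`. -/
lemma jacobiSym_of_dvd_add {c : ℤ} (hc : 4 ∣ c) {m n : ℕ} (hm : Odd m) (hn : Odd n)
    (h : c ∣ (m : ℤ) + n) : jacobiSym c m = (if c < 0 then -1 else 1) * jacobiSym c n := by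
  obtain ⟨e, rfl⟩ := hc
  rw [jacobiSym_four_mul _ hm, jacobiSym_four_mul _ hn]
  have h' : 4 * e.natAbs ∣ m + n := by
    have := Int.natAbs_dvd_natAbs.mpr h
    rw [Int.natAbs_mul] at this
    exact_mod_cast this
  have key := jacobiSym_nat_of_dvd_add hm hn h'
  split_ifs with hneg
  · -- for `c < 0` the sign comes from `(-1 / m) = -(-1 / n)`, since `m + n` is divisible by `4`
    have he : e = -(e.natAbs : ℤ) := by omega
    rw [he, jacobiSym.neg _ hm, jacobiSym.neg _ hn, key,
      χ₄_of_four_dvd_add (dvd_trans (Dvd.intro _ rfl) h')]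
    ring
  · have he : e = (e.natAbs : ℤ) := by omega
    rw [he, key, one_mul]

/-- Periodicity of the Kronecker symbol in its lower argument, across a change of sign too. -/
lemma kronecker_add_mul_self {c d : ℤ} (hc : 4 ∣ c) (hd : Odd d) (n : ℤ) :
    kronecker c (d + n * c) = kronecker c d := by
  have hd' : Odd (d + n * c) := by
    obtain ⟨e, rfl⟩ := hc
    exact hd.add_even ⟨n * 2 * e, by ring⟩
  rw [kronecker_of_odd _ hd', kronecker_of_odd _ hd]
  have ho := Int.natAbs_odd.mpr hd
  have ho' := Int.natAbs_odd.mpr hd'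
  rcases lt_or_ge d 0 with h1 | h1 <;> rcases lt_or_ge (d + n * c) 0 with h2 | h2
  · have hdvd : c ∣ ((d + n * c).natAbs : ℤ) - d.natAbs := by
      rw [Int.ofNat_natAbs_of_nonpos h1.le, Int.ofNat_natAbs_of_nonpos h2.le]
      exact ⟨-n, by ring⟩
    rw [jacobiSym_eq_of_dvd_sub hc ho' ho hdvd]
    simp [h1, h2]
  · have hdvd : c ∣ ((d + n * c).natAbs : ℤ) + d.natAbs := by
      rw [Int.ofNat_natAbs_of_nonpos h1.le, Int.natAbs_of_nonneg h2]
      exact ⟨n, by ring⟩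
    rw [jacobiSym_of_dvd_add hc ho' ho hdvd]
    simp [h1, h2.not_gt]
  · have hdvd : c ∣ ((d + n * c).natAbs : ℤ) + d.natAbs := by
      rw [Int.ofNat_natAbs_of_nonpos h2.le, Int.natAbs_of_nonneg h1]
      exact ⟨-n, by ring⟩
    rw [jacobiSym_of_dvd_add hc ho' ho hdvd]
    simp only [h2, h1.not_gt, true_and, false_and, if_false, one_mul]
    split_ifs <;> ring
  · have hdvd : c ∣ ((d + n * c).natAbs : ℤ) - d.natAbs := by
      rw [Int.natAbs_of_nonneg h1, Int.natAbs_of_nonneg h2]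
      exact ⟨n, by ring⟩
    rw [jacobiSym_eq_of_dvd_sub hc ho' ho hdvd]
    simp [h1.not_gt, h2.not_gt]

lemma kronecker_four_mul (c : ℤ) {d : ℤ} (hd : Odd d) : kronecker (4 * c) d = kronecker c d := by
  rw [kronecker_of_odd _ hd, kronecker_of_odd _ hd, jacobiSym_four_mul _ (Int.natAbs_odd.mpr hd)]
  have h : 4 * c < 0 ↔ c < 0 := by omega
  simp only [h]

lemma kronecker_neg_four {d : ℤ} (hd : Odd d) : kronecker (-4) d = ZMod.χ₄ (d : ZMod 4) := by
  have ho := Int.natAbs_odd.mpr hd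
  rw [kronecker_of_odd _ hd, show (-4 : ℤ) = 4 * (-1) by norm_num, jacobiSym_four_mul _ ho,
    jacobiSym.at_neg_one ho]
  rcases lt_or_ge d 0 with h1 | h1
  · have h2 : (d : ZMod 4) = -((d.natAbs : ℕ) : ZMod 4) := by
      rw [← Int.cast_natCast, Int.ofNat_natAbs_of_nonpos h1.le]; simp
    rw [h2]
    simp only [h1, true_and]
    generalize ((d.natAbs : ℕ) : ZMod 4) = x
    revert x; decide
  · have h2 : (d : ZMod 4) = ((d.natAbs : ℕ) : ZMod 4) := by
      rw [← Int.cast_natCast, Int.natAbs_of_nonneg h1]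
    rw [h2]
    simp [h1.not_gt]

/-- `(-4 / d)` is `1` for `d ≡ 1` and `-1` for `d ≡ 3` modulo `4`, whatever the sign of `d`. -/
lemma kronecker_neg_four_cases {d : ℤ} (hd : Odd d) :
    (d % 4 = 1 ∧ kronecker (-4) d = 1) ∨ (d % 4 = 3 ∧ kronecker (-4) d = -1) := by
  rw [kronecker_neg_four hd, ZMod.χ₄_int_eq_if_mod_four]
  rcases hd with ⟨k, rfl⟩
  have : (2 * k + 1) % 4 = 1 ∨ (2 * k + 1) % 4 = 3 := by omega
  rcases this with h | h <;> simp [h]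

lemma kronecker_add_mul_left {c d : ℤ} (hd : Odd d) (hpos : 0 < d) (n : ℤ) :
    kronecker (c + n * d) d = kronecker c d := by
  rw [kronecker_of_odd _ hd, kronecker_of_odd _ hd]
  simp only [hpos.not_gt, false_and, if_false, one_mul]
  apply jacobiSym.mod_left'
  rw [Int.natAbs_of_nonneg hpos.le]
  simp

/-- For the conventions of Kronecker's symbol, changing both signs costs `(-4 / d)`, and a further
sign for `c > 0`, in which case the symbol on the left has two negative arguments. -/
lemma kronecker_neg_neg {c d : ℤ} (hd : Odd d) (hpos : 0 < d) :
    kronecker (-c) (-d) = (if 0 < c then -1 else 1) * kronecker (-4) d * kronecker c d := by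
  rw [kronecker_of_odd _ hd.neg, kronecker_of_odd c hd, kronecker_of_odd (-4) hd, Int.natAbs_neg,
    jacobiSym.neg _ (Int.natAbs_odd.mpr hd), show (-4 : ℤ) = 4 * (-1) by norm_num,
    jacobiSym_four_mul _ (Int.natAbs_odd.mpr hd), jacobiSym.at_neg_one (Int.natAbs_odd.mpr hd)]
  simp [hpos, hpos.not_gt]

/-! ### Automorphy factors -/

lemma coe_smul_eq (γ : Matrix.SpecialLinearGroup (Fin 2) ℤ) (τ : ℍ) :
    ((γ • τ : ℍ) : ℂ) = ((γ 0 0 : ℂ) * τ + (γ 0 1 : ℂ)) / cocycle γ τ := by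
  rw [coe_specialLinearGroup_apply]
  simp [cocycle]

lemma cocycle_eq_denom (γ : Matrix.SpecialLinearGroup (Fin 2) ℤ) (τ : ℍ) :
    cocycle γ τ = denom γ τ := by
  simp [cocycle, denom]

lemma cocycle_ne_zero (γ : Matrix.SpecialLinearGroup (Fin 2) ℤ) (τ : ℍ) : cocycle γ τ ≠ 0 := by
  rw [cocycle_eq_denom]
  exact denom_ne_zero _ _

lemma cocycle_mul (γ δ : Matrix.SpecialLinearGroup (Fin 2) ℤ) (τ : ℍ) :
    cocycle (γ * δ) τ = cocycle γ (δ • τ) * cocycle δ τ := by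
  have h := cocycle_ne_zero δ τ
  rw [cocycle, cocycle.eq_1 γ, coe_smul_eq, add_mul, mul_assoc, div_mul_cancel₀ _ h, cocycle]
  simp [Matrix.mul_apply, Fin.sum_univ_two]
  ring

lemma im_smul_eq (γ : Matrix.SpecialLinearGroup (Fin 2) ℤ) (τ : ℍ) :
    (γ • τ).im = τ.im / ‖cocycle γ τ‖ ^ 2 := by
  rw [ModularGroup.im_smul_eq_div_normSq, cocycle_eq_denom, Complex.normSq_eq_norm_sq]

lemma cocycle_neg (γ : Matrix.SpecialLinearGroup (Fin 2) ℤ) (τ : ℍ) :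
    cocycle (-γ) τ = -cocycle γ τ := by
  simp [cocycle]
  ring

lemma factor_one (γ : Matrix.SpecialLinearGroup (Fin 2) ℤ) (τ : ℍ) :
    factor 1 γ τ = (kronecker (γ 1 0) (γ 1 1) : ℂ) *
      (kronecker (-4) (γ 1 1) : ℂ) ^ (-(1 / 2) : ℂ) * cocycle γ τ ^ (1 / 2 : ℂ) := by
  simp [factor]

lemma odd_of_four_dvd {γ : Matrix.SpecialLinearGroup (Fin 2) ℤ} (h : 4 ∣ γ 1 0) :
    Odd (γ 1 1) := by
  have h1 := γ.det_coe
  rw [Matrix.det_fin_two] at h1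
  obtain ⟨k, hk⟩ := h
  rw [hk] at h1
  rcases Int.even_or_odd (γ 1 1) with ⟨m, hm⟩ | h
  · rw [hm] at h1
    exfalso
    have : 2 * (γ 0 0 * m - γ 0 1 * (2 * k)) = 1 := by linarith
    omega
  · exact h

/-- The weight `5/2` factor is the weight `1/2` factor times `(c z + d) ^ 2`. -/
lemma factor_five {γ : Matrix.SpecialLinearGroup (Fin 2) ℤ} (h : 4 ∣ γ 1 0) (τ : ℍ) :
    factor 5 γ τ = cocycle γ τ ^ 2 * factor 1 γ τ := by
  have hne := cocycle_ne_zero γ τ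
  have e5 : ¬ Even (5 : ℤ) := by decide
  have key : ∀ x : ℂ, x ≠ 0 → x ^ ((5 : ℂ) / 2) = x ^ 2 * x ^ (1 / 2 : ℂ) := by
    intro x hx
    rw [show (5 : ℂ) / 2 = (2 : ℕ) + 1 / 2 by norm_num, Complex.cpow_add _ _ hx,
      Complex.cpow_natCast]
  rw [factor_one, factor, if_neg e5]
  push_cast
  rw [Complex.cpow_neg, Complex.cpow_neg]
  have hk : (kronecker (-4) (γ 1 1) : ℂ) ≠ 0 ∧ (kronecker (-4) (γ 1 1) : ℂ) ^ 2 = 1 := by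
    rcases kronecker_neg_four_cases (odd_of_four_dvd h) with ⟨-, h⟩ | ⟨-, h⟩ <;> simp [h]
  rw [key _ hne, key _ hk.1, hk.2]
  ring

lemma neg_cpow_half_of_im_pos {x : ℂ} (hx : 0 < x.im) :
    (-x) ^ (1 / 2 : ℂ) = -Complex.I * x ^ (1 / 2 : ℂ) := by
  have h0 : x ≠ 0 := by rintro rfl; simp at hx
  rw [Complex.cpow_def_of_ne_zero (neg_ne_zero.mpr h0), Complex.cpow_def_of_ne_zero h0,
    Complex.log, Complex.log, norm_neg, Complex.arg_neg_eq_arg_sub_pi_of_im_pos hx]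
  rw [← Complex.exp_neg_pi_div_two_mul_I, ← Complex.exp_add]
  congr 1
  push_cast
  ring

lemma neg_cpow_half_of_im_neg_or {x : ℂ} (hx : x.im < 0 ∨ x.im = 0 ∧ 0 < x.re) :
    (-x) ^ (1 / 2 : ℂ) = Complex.I * x ^ (1 / 2 : ℂ) := by
  have h0 : x ≠ 0 := by rintro rfl; simp at hx
  rw [Complex.cpow_def_of_ne_zero (neg_ne_zero.mpr h0), Complex.cpow_def_of_ne_zero h0,
    Complex.log, Complex.log, norm_neg, Complex.arg_neg_eq_arg_add_pi_iff.mpr hx]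
  conv_rhs => arg 1; rw [← Complex.exp_pi_div_two_mul_I]
  rw [← Complex.exp_add]
  congr 1
  push_cast
  ring

lemma neg_one_cpow_neg_half : (-1 : ℂ) ^ (-(1 / 2) : ℂ) = -Complex.I := by
  rw [Complex.cpow_def_of_ne_zero (by norm_num), Complex.log_neg_one,
    ← Complex.exp_neg_pi_div_two_mul_I]
  congr 1
  ring

lemma cocycle_im (γ : Matrix.SpecialLinearGroup (Fin 2) ℤ) (τ : ℍ) :
    (cocycle γ τ).im = γ 1 0 * τ.im := by
  simp [cocycle]

/-- The factor depends on `γ` only up to sign. For `d > 0` the sign in the Kronecker symbol of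
`(-c, -d)` makes up for the branch of `(-x) ^ (1/2) = ± i x ^ (1/2)`, which depends on the sign
of `c`. -/
lemma factor_one_neg_of_pos {γ : Matrix.SpecialLinearGroup (Fin 2) ℤ} (h : 4 ∣ γ 1 0)
    (hpos : 0 < γ 1 1) (τ : ℍ) : factor 1 (-γ) τ = factor 1 γ τ := by
  have hd := odd_of_four_dvd h
  have hx : (-cocycle γ τ) ^ (1 / 2 : ℂ) =
      (if 0 < γ 1 0 then -1 else 1) * Complex.I * cocycle γ τ ^ (1 / 2 : ℂ) := by
    split_ifs with hc
    · rw [neg_cpow_half_of_im_pos]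
      · ring
      · rw [cocycle_im]; exact mul_pos (by exact_mod_cast hc) τ.im_pos
    · rw [neg_cpow_half_of_im_neg_or]
      · ring
      · rw [cocycle_im]
        rcases (not_lt.mp hc).lt_or_eq with h1 | h1
        · left; exact mul_neg_of_neg_of_pos (by exact_mod_cast h1) τ.im_pos
        · right; simp [h1, cocycle, hpos]
  have h4 : kronecker (-4) (-(γ 1 1)) = -kronecker (-4) (γ 1 1) := by
    rw [kronecker_neg_four hd, kronecker_neg_four hd.neg]
    push_cast
    generalize ((γ 1 1 : ℤ) : ZMod 4) = x
    revert x; decide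
  rw [factor_one, factor_one, cocycle_neg, hx]
  simp only [Matrix.SpecialLinearGroup.coe_neg, Matrix.neg_apply]
  rw [kronecker_neg_neg hd hpos, h4]
  have hI := Complex.I_mul_I
  rcases kronecker_neg_four_cases hd with ⟨-, h⟩ | ⟨-, h⟩ <;> rw [h] <;>
    split_ifs <;> push_cast <;> simp only [Complex.one_cpow, neg_one_cpow_neg_half] <;>
    grind

lemma factor_one_neg {γ : Matrix.SpecialLinearGroup (Fin 2) ℤ} (h : 4 ∣ γ 1 0) (τ : ℍ) :
    factor 1 (-γ) τ = factor 1 γ τ := by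
  rcases lt_trichotomy (γ 1 1) 0 with h1 | h1 | h1
  · rw [← factor_one_neg_of_pos (γ := -γ) (by simpa using h) (by simpa using h1), neg_neg]
  · have := odd_of_four_dvd h
    simp [h1] at this
  · exact factor_one_neg_of_pos h h1 τ

/-- The parabolic element `(1 0; 4 1)`, which generates `Γ₀(4)` together with `T` and `-1`. -/
def V : Matrix.SpecialLinearGroup (Fin 2) ℤ := ⟨!![1, 0; 4, 1], by simp [Matrix.det_fin_two]⟩

lemma coe_V : (V : Matrix (Fin 2) (Fin 2) ℤ) = !![1, 0; 4, 1] := rfl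

lemma mul_V_apply (γ : Matrix.SpecialLinearGroup (Fin 2) ℤ) :
    (γ * V) 1 0 = γ 1 0 + 4 * γ 1 1 ∧ (γ * V) 1 1 = γ 1 1 := by
  constructor <;>
    simp [coe_V, Matrix.mul_apply, Fin.sum_univ_two]
  ring

lemma cocycle_V (τ : ℍ) : cocycle V τ = 4 * τ + 1 := by
  simp [cocycle, V]

lemma coe_V_smul (τ : ℍ) : ((V • τ : ℍ) : ℂ) = τ / (4 * τ + 1) := by
  rw [coe_smul_eq, cocycle_V]
  simp [V]

lemma mul_cpow_of_arg {x y r : ℂ} (hx : x ≠ 0) (hy : y ≠ 0)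
    (h : x.arg + y.arg ∈ Set.Ioc (-Real.pi) Real.pi) : (x * y) ^ r = x ^ r * y ^ r := by
  rw [Complex.cpow_def_of_ne_zero (mul_ne_zero hx hy), Complex.cpow_def_of_ne_zero hx,
    Complex.cpow_def_of_ne_zero hy, Complex.log_mul hx hy h, add_mul, Complex.exp_add]

lemma arg_add_arg_mem_of_im_pos {x y : ℂ} (hx : 0 < x.im) (hy : 0 < y.im) (hxy : 0 < (x * y).im) :
    x.arg + y.arg ∈ Set.Ioc (-Real.pi) Real.pi := by
  have hx0 : x ≠ 0 := by rintro rfl; simp at hx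
  have hy0 : y ≠ 0 := by rintro rfl; simp at hy
  have ax : 0 < x.arg := lt_of_le_of_ne (Complex.arg_nonneg_iff.mpr hx.le)
    (fun h => by have := Complex.arg_eq_zero_iff.mp h.symm; linarith [this.2])
  have ay : 0 < y.arg := lt_of_le_of_ne (Complex.arg_nonneg_iff.mpr hy.le)
    (fun h => by have := Complex.arg_eq_zero_iff.mp h.symm; linarith [this.2])
  have bx := Complex.arg_le_pi x
  have bY := Complex.arg_le_pi y
  refine ⟨by linarith [Real.pi_pos], ?_⟩
  -- otherwise the sum of the arguments lies in `(π, 2 π]`, and its sine is not positive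
  by_contra hcon
  push Not at hcon
  have hs : Real.sin (x.arg + y.arg) ≤ 0 := by
    rw [← Real.sin_sub_two_pi]
    exact Real.sin_nonpos_of_nonpos_of_neg_pi_le (by linarith) (by linarith)
  have : (x * y).im = ‖x‖ * ‖y‖ * Real.sin (x.arg + y.arg) := by
    rw [Real.sin_add, Complex.mul_im]
    linear_combination -y.im * Complex.norm_mul_cos_arg x - y.re * Complex.norm_mul_sin_arg x
      - ‖x‖ * Real.cos x.arg * Complex.norm_mul_sin_arg y
      - ‖x‖ * Real.sin x.arg * Complex.norm_mul_cos_arg y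
  have h2 : 0 < ‖x‖ * ‖y‖ := by positivity
  nlinarith

/-- The chain rule for the weight `1/2` factor along `V`. For `d > 0` the principal square roots
multiply without a sign. -/
lemma factor_one_mul_V {γ : Matrix.SpecialLinearGroup (Fin 2) ℤ} (h : 4 ∣ γ 1 0)
    (hpos : 0 < γ 1 1) (τ : ℍ) :
    factor 1 (γ * V) τ = factor 1 γ (V • τ) * (4 * τ + 1) ^ (1 / 2 : ℂ) := by
  obtain ⟨h10, h11⟩ := mul_V_apply γ
  have hd := odd_of_four_dvd h
  have hy : 0 < (4 * (τ : ℂ) + 1).im := by simp [τ.im_pos]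
  have hy0 : (4 * (τ : ℂ) + 1) ≠ 0 := fun h => by simp [h] at hy
  rw [factor_one, factor_one, h10, h11, kronecker_add_mul_left hd hpos, cocycle_mul,
    cocycle_V, mul_cpow_of_arg (cocycle_ne_zero _ _) hy0]
  · ring
  have ay : 0 < (4 * (τ : ℂ) + 1).arg := lt_of_le_of_ne (Complex.arg_nonneg_iff.mpr hy.le)
    (fun h => by have := Complex.arg_eq_zero_iff.mp h.symm; linarith [this.2])
  rcases lt_trichotomy (γ 1 0) 0 with hc | hc | hc
  · have hx : (cocycle γ (V • τ)).im < 0 := by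
      rw [cocycle_im]; exact mul_neg_of_neg_of_pos (by exact_mod_cast hc) (V • τ).im_pos
    have ax := Complex.arg_neg_iff.mpr hx
    exact ⟨by linarith [Complex.neg_pi_lt_arg (cocycle γ (V • τ))],
      by linarith [Complex.arg_le_pi (4 * (τ : ℂ) + 1)]⟩
  · have hx : cocycle γ (V • τ) = ((γ 1 1 : ℝ) : ℂ) := by simp [cocycle, hc]
    rw [hx, Complex.arg_ofReal_of_nonneg (by exact_mod_cast hpos.le), zero_add]
    exact Complex.arg_mem_Ioc _
  · apply arg_add_arg_mem_of_im_pos _ hy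
    · rw [← cocycle_V, ← cocycle_mul, cocycle_im, h10]
      exact mul_pos (by exact_mod_cast (by omega)) τ.im_pos
    · rw [cocycle_im]; exact mul_pos (by exact_mod_cast hc) (V • τ).im_pos

lemma mul_T_zpow_apply (γ : Matrix.SpecialLinearGroup (Fin 2) ℤ) (n : ℤ) :
    (γ * ModularGroup.T ^ n) 1 0 = γ 1 0 ∧
    (γ * ModularGroup.T ^ n) 1 1 = γ 1 1 + n * γ 1 0 := by
  constructor <;>
    simp [Matrix.mul_apply, Fin.sum_univ_two, ModularGroup.coe_T_zpow]
  ring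

lemma cocycle_T_zpow (n : ℤ) (τ : ℍ) : cocycle (ModularGroup.T ^ n) τ = 1 := by
  simp [cocycle, ModularGroup.coe_T_zpow]

lemma coe_T_zpow_smul (n : ℤ) (τ : ℍ) : ((ModularGroup.T ^ n • τ : ℍ) : ℂ) = τ + n := by
  rw [modular_T_zpow_smul, coe_vadd, add_comm]
  simp

lemma factor_one_mul_T_zpow {γ : Matrix.SpecialLinearGroup (Fin 2) ℤ} (h : 4 ∣ γ 1 0) (n : ℤ)
    (τ : ℍ) :
    factor 1 (γ * ModularGroup.T ^ n) τ = factor 1 γ (ModularGroup.T ^ n • τ) := by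
  have hd := odd_of_four_dvd h
  obtain ⟨h10, h11⟩ := mul_T_zpow_apply γ n
  have h4 : kronecker (-4) (γ 1 1 + n * γ 1 0) = kronecker (-4) (γ 1 1) := by
    obtain ⟨e, he⟩ := h
    rw [show γ 1 1 + n * γ 1 0 = γ 1 1 + (-(n * e)) * (-4) by rw [he]; ring]
    exact kronecker_add_mul_self (by norm_num) hd _
  rw [factor_one, factor_one, cocycle_mul, cocycle_T_zpow, mul_one, h10, h11,
    kronecker_add_mul_self h hd, h4]

/-! ### The theta series on `Γ₀(4)` -/

lemma q_eq_qParam (z : ℂ) : q z = Function.Periodic.qParam 1 z := by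
  simp [q, Function.Periodic.qParam]

lemma norm_q_lt_one (τ : ℍ) : ‖q τ‖ < 1 := by
  rw [q_eq_qParam]
  exact_mod_cast norm_qParam_lt_one 1 τ

lemma q_add_intCast (z : ℂ) (n : ℤ) : q (z + n) = q z := by
  rw [q, q, mul_add, Complex.exp_add, mul_comm _ (n : ℂ), Complex.exp_int_mul_two_pi_mul_I, mul_one]

lemma q_natCast_mul (m : ℕ) (z : ℂ) : q (m * z) = q z ^ m := by
  rw [q, q, ← Complex.exp_nat_mul]
  ring_nf

lemma q_zpow_sq (z : ℂ) (n : ℤ) :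
    q z ^ (n ^ 2) = Complex.exp (Real.pi * Complex.I * (n : ℂ) ^ 2 * (2 * z)) := by
  rw [q, ← Complex.exp_int_mul]
  push_cast
  ring_nf

lemma q_zpow_sq_eq_term (z : ℂ) (n : ℤ) : q z ^ (n ^ 2) = jacobiTheta₂_term n 0 (2 * z) := by
  rw [q_zpow_sq, jacobiTheta₂_term]
  simp

lemma theta_eq_jacobiTheta (z : ℂ) : θ z = jacobiTheta (2 * z) :=
  tsum_congr fun n => q_zpow_sq z n

lemma hasSum_theta {z : ℂ} (hz : 0 < z.im) : HasSum (fun n : ℤ => q z ^ (n ^ 2)) (θ z) := by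
  rw [theta_eq_jacobiTheta, jacobiTheta_eq_jacobiTheta₂]
  simp_rw [q_zpow_sq_eq_term]
  exact hasSum_jacobiTheta₂_term 0 (by simpa using hz)

/-- The theta series may be differentiated term by term. -/
lemma hasSum_deriv_theta {z : ℂ} (hz : 0 < z.im) :
    HasDerivAt θ (deriv θ z) z ∧
    HasSum (fun n : ℤ => 2 * Real.pi * Complex.I * (n : ℂ) ^ 2 * q z ^ (n ^ 2)) (deriv θ z) := by
  have hz2 : 0 < (2 * z).im := by simpa using hz
  have hfun : θ = fun w => jacobiTheta₂ 0 (2 * w) := by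
    ext w
    rw [theta_eq_jacobiTheta, jacobiTheta_eq_jacobiTheta₂]
  have h1 := (hasFDerivAt_jacobiTheta₂ 0 hz2).comp_hasDerivAt z
    ((hasDerivAt_const z (0 : ℂ)).prodMk ((hasDerivAt_id z).const_mul 2))
  have h2 := (hasSum_jacobiTheta₂_term_fderiv 0 hz2).mapL
    (ContinuousLinearMap.apply ℂ ℂ ((0 : ℂ), (2 * 1 : ℂ)))
  have h3 : HasDerivAt θ (jacobiTheta₂_fderiv 0 (2 * z) (0, 2 * 1)) z := by
    rw [hfun]; exact h1
  rw [h3.deriv]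
  refine ⟨h3, ?_⟩
  convert! h2 using 1
  ext n
  rw [q_zpow_sq]
  simp [jacobiTheta₂_term_fderiv]
  ring

lemma theta_add_intCast (z : ℂ) (n : ℤ) : θ (z + n) = θ z := by
  simp only [θ, q_add_intCast]

lemma theta_neg_inv (z : ℂ) (hz : 0 < z.im) :
    θ (-1 / (4 * z)) = (-2 * Complex.I * z) ^ (1 / 2 : ℂ) * θ z := by
  have hz0 : z ≠ 0 := by rintro rfl; simp at hz
  rw [theta_eq_jacobiTheta, theta_eq_jacobiTheta]
  have h := jacobiTheta_S_smul ⟨2 * z, by simpa using hz⟩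
  rw [modular_S_smul] at h
  simp only at h
  rw [show -Complex.I * (2 * z) = -2 * Complex.I * z by ring] at h
  rw [← h]
  congr 1
  field_simp
  norm_num

lemma theta_V_smul (τ : ℍ) :
    θ ((V • τ : ℍ) : ℂ) = (4 * (τ : ℂ) + 1) ^ (1 / 2 : ℂ) * θ τ := by
  have hτ := ne_zero τ
  have hy : 0 < (4 * (τ : ℂ) + 1).im := by simp [τ.im_pos]
  have hy0 : (4 * (τ : ℂ) + 1) ≠ 0 := fun h => by simp [h] at hy
  set w : ℍ := V • τ with hw
  have hwc : (w : ℂ) = τ / (4 * τ + 1) := coe_V_smul τ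
  have hre : ∀ v : ℍ, 0 < (-2 * Complex.I * (v : ℂ)).re := fun v => by
    simp [v.im_pos]
  have hne : ∀ v : ℍ, (-2 * Complex.I * (v : ℂ)) ≠ 0 := fun v h => by
    have := hre v
    rw [h] at this
    simp at this
  -- the involution `z ↦ -1 / (4 z)` carries `V` into the translation by `-1`
  have h1 : θ (-1 / (4 * (w : ℂ))) = θ (-1 / (4 * (τ : ℂ))) := by
    rw [← theta_add_intCast (-1 / (4 * (τ : ℂ))) (-1), hwc]
    congr 1
    field_simp
    push_cast
    ring
  rw [theta_neg_inv _ w.im_pos, theta_neg_inv _ τ.im_pos] at h1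
  -- both arguments lie in the right half plane, so their quotient has the expected square root
  have h2 : (-2 * Complex.I * (τ : ℂ)) ^ (1 / 2 : ℂ) =
      (4 * (τ : ℂ) + 1) ^ (1 / 2 : ℂ) * (-2 * Complex.I * (w : ℂ)) ^ (1 / 2 : ℂ) := by
    have ha := Complex.abs_arg_lt_pi_div_two_iff.mpr (Or.inl (hre τ))
    have hb := Complex.abs_arg_lt_pi_div_two_iff.mpr (Or.inl (hre w))
    rw [abs_lt] at ha hb
    have hbpi : (-2 * Complex.I * (w : ℂ)).arg ≠ Real.pi := by linarith [hb.2, Real.pi_pos]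
    have e1 : 4 * (τ : ℂ) + 1 = (-2 * Complex.I * (τ : ℂ)) * (-2 * Complex.I * (w : ℂ))⁻¹ := by
      have := Complex.I_ne_zero
      rw [hwc]
      field_simp
    rw [e1, mul_cpow_of_arg (hne τ) (inv_ne_zero (hne w)), Complex.inv_cpow _ _ hbpi,
      inv_mul_cancel_right₀]
    · rw [Ne, Complex.cpow_eq_zero_iff]
      exact fun h => hne w h.1
    · rw [Complex.arg_inv, if_neg hbpi]
      exact ⟨by linarith [ha.1, hb.2], by linarith [ha.2, hb.1]⟩
  rw [h2] at h1
  have h3 : (-2 * Complex.I * (w : ℂ)) ^ (1 / 2 : ℂ) ≠ 0 := by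
    rw [Ne, Complex.cpow_eq_zero_iff]
    exact fun h => hne w h.1
  apply mul_left_cancel₀ h3
  rw [h1]
  ring

/-- `θ` transforms under `γ` with the factor of weight `1/2`. -/
def ThetaLaw (γ : Matrix.SpecialLinearGroup (Fin 2) ℤ) : Prop :=
  ∀ τ : ℍ, θ ((γ • τ : ℍ) : ℂ) = factor 1 γ τ * θ τ

lemma thetaLaw_neg {γ : Matrix.SpecialLinearGroup (Fin 2) ℤ} (h : 4 ∣ γ 1 0) :
    ThetaLaw (-γ) ↔ ThetaLaw γ := by
  simp only [ThetaLaw, factor_one_neg h, ModularGroup.SL_neg_smul]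

lemma thetaLaw_mul_T_zpow {γ : Matrix.SpecialLinearGroup (Fin 2) ℤ} (h : 4 ∣ γ 1 0) (n : ℤ)
    (hγ : ThetaLaw (γ * ModularGroup.T ^ n)) : ThetaLaw γ := by
  intro τ
  have h1 := hγ (ModularGroup.T ^ (-n) • τ)
  rw [factor_one_mul_T_zpow h, mul_smul, smul_smul (ModularGroup.T ^ n), ← zpow_add,
    add_neg_cancel, zpow_zero, one_smul, coe_T_zpow_smul, theta_add_intCast] at h1
  exact h1

lemma thetaLaw_mul_V_of_pos {γ : Matrix.SpecialLinearGroup (Fin 2) ℤ} (h : 4 ∣ γ 1 0)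
    (hpos : 0 < γ 1 1) : ThetaLaw (γ * V) ↔ ThetaLaw γ := by
  have key : ∀ τ : ℍ, (θ ((γ * V) • τ : ℍ) = factor 1 (γ * V) τ * θ τ ↔
      θ ((γ • (V • τ) : ℍ) : ℂ) = factor 1 γ (V • τ) * θ ((V • τ : ℍ) : ℂ)) := by
    intro τ
    rw [mul_smul, factor_one_mul_V h hpos, theta_V_smul, mul_assoc]
  refine ⟨fun H τ => ?_, fun H τ => (key τ).mpr (H _)⟩
  have := (key (V⁻¹ • τ)).mp (H _)
  rwa [smul_inv_smul] at this

lemma thetaLaw_mul_V {γ : Matrix.SpecialLinearGroup (Fin 2) ℤ} (h : 4 ∣ γ 1 0) :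
    ThetaLaw (γ * V) ↔ ThetaLaw γ := by
  have h4 : 4 ∣ (γ * V) 1 0 := by
    rw [(mul_V_apply γ).1]; exact dvd_add h ⟨_, rfl⟩
  rcases lt_trichotomy (γ 1 1) 0 with h1 | h1 | h1
  · rw [← thetaLaw_neg h4, ← thetaLaw_neg h, ← neg_mul]
    exact thetaLaw_mul_V_of_pos (by simpa using h) (by simpa using h1)
  · have := odd_of_four_dvd h
    simp [h1] at this
  · exact thetaLaw_mul_V_of_pos h h1

lemma thetaLaw_of_lower_left_eq_zero {γ : Matrix.SpecialLinearGroup (Fin 2) ℤ} (h : γ 1 0 = 0) :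
    ThetaLaw γ := by
  have h4 : 4 ∣ γ 1 0 := by simp [h]
  wlog hpos : 0 < γ 1 1 generalizing γ
  · rw [← thetaLaw_neg h4]
    refine this (by simpa using h) (by simpa using h4) ?_
    have h0 : γ 1 1 ≠ 0 := fun h0 => by
      have := odd_of_four_dvd h4
      simp [h0] at this
    simp only [Matrix.SpecialLinearGroup.coe_neg, Matrix.neg_apply]
    omega
  have hdet := γ.det_coe
  rw [Matrix.det_fin_two, h, mul_zero, sub_zero] at hdet
  have h11 : γ 1 1 = 1 := by
    rcases Int.eq_one_or_neg_one_of_mul_eq_one' hdet with h | h <;> omega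
  have h00 : γ 0 0 = 1 := by simpa [h11] using hdet
  intro τ
  have e1 : ((γ • τ : ℍ) : ℂ) = τ + (γ 0 1 : ℤ) := by
    rw [coe_smul_eq]
    simp [cocycle, h, h11, h00]
  rw [e1, theta_add_intCast, factor_one]
  simp [cocycle, h, h11, kronecker, show jacobiSym (-4) 1 = 1 from jacobiSym.one_right _]

/-- Hecke's theta transformation law. Right multiplication by powers of `T` and of `V` runs the
Euclidean algorithm on the lower row of `γ`: since `d` is odd and `4 ∣ c`, it can be arranged that
`2 |d| < |c|`, and then `c ± 4 d` is smaller than `c` in absolute value for a suitable sign. -/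
theorem thetaLaw_of_four_dvd {γ : Matrix.SpecialLinearGroup (Fin 2) ℤ} (h : 4 ∣ γ 1 0) :
    ThetaLaw γ := by
  induction hN : (γ 1 0).natAbs using Nat.strong_induction_on generalizing γ with
  | _ N ih =>
  rcases eq_or_ne (γ 1 0) 0 with h0 | h0
  · exact thetaLaw_of_lower_left_eq_zero h0
  obtain ⟨n, hn⟩ : ∃ n : ℤ, 2 * (γ 1 1 + n * γ 1 0).natAbs < (γ 1 0).natAbs := by
    have ho := odd_of_four_dvd h
    obtain ⟨e, he⟩ := h
    refine ⟨-((γ 1 1).bdiv (γ 1 0).natAbs * (γ 1 0).sign), ?_⟩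
    have e1 : γ 1 1 + -((γ 1 1).bdiv (γ 1 0).natAbs * (γ 1 0).sign) * γ 1 0 =
        (γ 1 1).bmod (γ 1 0).natAbs := by
      rw [Int.bmod_eq_self_sub_mul_bdiv, ← Int.sign_mul_self_eq_natAbs]
      ring
    rw [e1]
    have hpos : 0 < (γ 1 0).natAbs := Int.natAbs_pos.mpr h0
    have b1 := Int.le_bmod (x := γ 1 1) hpos
    have b2 := Int.bmod_lt (x := γ 1 1) hpos
    have ho2 : Odd ((γ 1 1).bmod (γ 1 0).natAbs) := by
      rw [← e1, he]
      exact ho.add_even ⟨-(((γ 1 1).bdiv (4 * e).natAbs) * (4 * e).sign) * (2 * e), by ring⟩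
    obtain ⟨k, hk⟩ := ho2
    omega
  apply thetaLaw_mul_T_zpow h n
  obtain ⟨t10, t11⟩ := mul_T_zpow_apply γ n
  have h4 : 4 ∣ (γ * ModularGroup.T ^ n) 1 0 := by rwa [t10]
  have hodd := odd_of_four_dvd h4
  rw [t11] at hodd
  generalize γ * ModularGroup.T ^ n = δ at *
  rw [← t11] at hodd
  rw [← t11, ← t10] at hn
  rw [← t10] at hN
  have hd0 : δ 1 1 ≠ 0 := by intro h0; simp [h0] at hodd
  by_cases hs : 0 < δ 1 0 * δ 1 1
  · have hV : (δ * V⁻¹) 1 0 = δ 1 0 - 4 * δ 1 1 := by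
      have := (mul_V_apply (δ * V⁻¹)).1
      have e2 := (mul_V_apply (δ * V⁻¹)).2
      rw [inv_mul_cancel_right] at this e2
      rw [← e2] at this
      linarith
    have h4' : 4 ∣ (δ * V⁻¹) 1 0 := by rw [hV]; exact dvd_sub h4 ⟨_, rfl⟩
    rw [show δ = δ * V⁻¹ * V by simp, thetaLaw_mul_V h4']
    refine ih _ ?_ h4' rfl
    rw [hV, ← hN]
    rcases pos_and_pos_or_neg_and_neg_of_mul_pos hs with h | h <;> omega
  · rw [← thetaLaw_mul_V h4]
    have hV := (mul_V_apply δ).1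
    have h4' : 4 ∣ (δ * V) 1 0 := by rw [hV]; exact dvd_add h4 ⟨_, rfl⟩
    refine ih _ ?_ h4' rfl
    rw [hV, ← hN]
    have hc0 : δ 1 0 ≠ 0 := by rwa [t10]
    have hs' : δ 1 0 * δ 1 1 < 0 := lt_of_le_of_ne (not_lt.mp hs) (mul_ne_zero hc0 hd0)
    rcases mul_neg_iff.mp hs' with h | h <;> omega

/-! ### The theta series over odd integers and Gauss' product formula -/

/-- `θ(z) - θ(4 z)`, the theta series `∑ q^{s²}` over odd `s`. -/
def thetaOdd (z : ℂ) : ℂ := θ z - θ (4 * z)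

lemma hasSum_int_odd {u : ℤ → ℂ} {A B : ℂ} (hA : HasSum u A) (hB : HasSum (fun t => u (2 * t)) B) :
    HasSum (fun t => u (2 * t + 1)) (A - B) := by
  have i0 : Function.Injective (fun t : ℤ => 2 * t) := fun x y h => by simpa using h
  have i1 : Function.Injective (fun t : ℤ => 2 * t + 1) := fun x y h => by simpa using h
  have hE : HasSum (fun s : ℤ => if Even s then u s else 0) B := by
    rw [← i0.hasSum_iff]
    · simpa [Function.comp_def] using hB
    · intro x hx
      rw [if_neg]
      rintro ⟨y, rfl⟩
      exact hx ⟨y, by ring⟩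
  have h2 := hA.sub hE
  rw [← i1.hasSum_iff] at h2
  · convert! h2 using 1
    ext t
    rw [Function.comp, if_neg (by rintro ⟨k, hk⟩; omega), sub_zero]
  · intro x hx
    rw [if_pos, sub_self]
    rcases Int.even_or_odd' x with ⟨k, rfl | rfl⟩
    · simp
    · exact absurd ⟨k, rfl⟩ hx

lemma q_four_mul_zpow_sq (z : ℂ) (t : ℤ) : q (4 * z) ^ (t ^ 2) = q z ^ ((2 * t) ^ 2) := by
  rw [show (4 : ℂ) * z = ((4 : ℕ) : ℂ) * z by norm_num, q_natCast_mul, ← zpow_natCast, ← zpow_mul]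
  congr 1
  push_cast
  ring

lemma hasSum_thetaOdd {z : ℂ} (hz : 0 < z.im) :
    HasSum (fun t : ℤ => q z ^ ((2 * t + 1) ^ 2)) (thetaOdd z) := by
  have h4 : 0 < (4 * z).im := by simpa using hz
  have hB := hasSum_theta h4
  simp only [q_four_mul_zpow_sq] at hB
  exact hasSum_int_odd (u := fun s : ℤ => q z ^ (s ^ 2)) (hasSum_theta hz) hB

lemma hasSum_deriv_thetaOdd {z : ℂ} (hz : 0 < z.im) :
    HasDerivAt thetaOdd (deriv thetaOdd z) z ∧
    HasSum (fun t : ℤ => 2 * Real.pi * Complex.I * ((2 * t + 1 : ℤ) : ℂ) ^ 2 *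
      q z ^ ((2 * t + 1) ^ 2)) (deriv thetaOdd z) := by
  have h4 : 0 < (4 * z).im := by simpa using hz
  obtain ⟨d1, s1⟩ := hasSum_deriv_theta hz
  obtain ⟨d4, s4⟩ := hasSum_deriv_theta h4
  have hd : HasDerivAt thetaOdd (deriv θ z - deriv θ (4 * z) * (4 * 1)) z :=
    d1.sub (d4.comp z ((hasDerivAt_id z).const_mul 4))
  rw [hd.deriv]
  refine ⟨hd, ?_⟩
  refine hasSum_int_odd
    (u := fun s : ℤ => 2 * Real.pi * Complex.I * (s : ℂ) ^ 2 * q z ^ (s ^ 2)) s1 ?_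
  convert! s4.mul_right (4 * 1) using 1
  ext t
  rw [q_four_mul_zpow_sq]
  push_cast
  ring

/-- The partial products of `∏ (1 - x^{2k}) / (1 - x^{2k-1})`. -/
def gaussProd (x : ℂ) (n : ℕ) : ℂ :=
  ∏ k ∈ Finset.range n, (1 - x ^ (2 * k + 2)) / (1 - x ^ (2 * k + 1))

lemma one_sub_pow_ne_zero {x : ℂ} (hx : ‖x‖ < 1) (k : ℕ) : 1 - x ^ (k + 1) ≠ 0 := by
  intro h
  have h1 : ‖x ^ (k + 1)‖ < 1 := by
    rw [norm_pow]
    exact pow_lt_one₀ (norm_nonneg _) hx (by omega)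
  rw [← sub_eq_zero.mp h] at h1
  simp at h1

lemma gaussProd_succ (x : ℂ) (n : ℕ) :
    gaussProd x (n + 1) = gaussProd x n * ((1 - x ^ (2 * n + 2)) / (1 - x ^ (2 * n + 1))) :=
  Finset.prod_range_succ _ _

lemma gaussProd_ne_zero {x : ℂ} (hx : ‖x‖ < 1) (n : ℕ) : gaussProd x n ≠ 0 :=
  Finset.prod_ne_zero_iff.mpr fun _ _ =>
    div_ne_zero (one_sub_pow_ne_zero hx _) (one_sub_pow_ne_zero hx _)

/-- A telescoping sum: its value is the increment of Shanks' sum `∑ P_n / P_s x^{s (2n+1)}` caused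
by passing from `n` to `n + 1` in each of the first `m` summands. -/
lemma shanks_telescope {x : ℂ} (hx : ‖x‖ < 1) (n m : ℕ) :
    ∑ s ∈ Finset.range m, (gaussProd x (n + 1) / gaussProd x s * x ^ (s * (2 * n + 3)) -
      gaussProd x n / gaussProd x s * x ^ (s * (2 * n + 1))) =
    gaussProd x n / (1 - x ^ (2 * n + 1)) *
      (x ^ (m * (2 * n + 1)) * (1 - x ^ (2 * m)) / gaussProd x m) := by
  induction m with
  | zero => simp
  | succ m ih =>
    rw [Finset.sum_range_succ, ih, gaussProd_succ, gaussProd_succ]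
    have h1 := gaussProd_ne_zero hx m
    have h2 := one_sub_pow_ne_zero hx (2 * n)
    have h3 := one_sub_pow_ne_zero hx (2 * m)
    have h4 := one_sub_pow_ne_zero hx (2 * m + 1)
    rw [show 2 * (m + 1) = 2 * m + 1 + 1 by ring, show 2 * m + 2 = 2 * m + 1 + 1 by ring]
    field_simp
    ring

/-- Shanks' finite form of Gauss' identity for triangular numbers. -/
lemma shanks_identity {x : ℂ} (hx : ‖x‖ < 1) (n : ℕ) :
    ∑ s ∈ Finset.range (2 * n), x ^ (s * (s + 1) / 2) =
    ∑ s ∈ Finset.range n, gaussProd x n / gaussProd x s * x ^ (s * (2 * n + 1)) := by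
  induction n with
  | zero => simp
  | succ n ih =>
    rw [show 2 * (n + 1) = 2 * n + 1 + 1 by ring, Finset.sum_range_succ, Finset.sum_range_succ, ih,
      Finset.sum_range_succ _ n]
    have h := shanks_telescope hx n n
    rw [Finset.sum_sub_distrib, sub_eq_iff_eq_add] at h
    rw [show 2 * n + 1 + 1 + 1 = 2 * n + 3 by ring, h, gaussProd_succ]
    have e1 : 2 * n * (2 * n + 1) / 2 = n * (2 * n + 1) := by
      rw [mul_assoc, Nat.mul_div_cancel_left _ (by norm_num)]
    have e2 : (2 * n + 1) * (2 * n + 1 + 1) / 2 = (n + 1) * (2 * n + 1) := by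
      rw [show (2 * n + 1) * (2 * n + 1 + 1) = 2 * ((n + 1) * (2 * n + 1)) by ring,
        Nat.mul_div_cancel_left _ (by norm_num)]
    rw [e1, e2]
    have h1 := gaussProd_ne_zero hx n
    have h2 := one_sub_pow_ne_zero hx (2 * n)
    field_simp
    ring

/-- The Euler product `∏ (1 - x^n)` over `n ≥ 1`. -/
def eulerProd (x : ℂ) : ℂ := ∏' n : ℕ, (1 - x ^ (n + 1))

lemma tendsto_eulerProd {x : ℂ} (hx : ‖x‖ < 1) :
    Filter.Tendsto (fun n => ∏ k ∈ Finset.range n, (1 - x ^ (k + 1))) Filter.atTop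
      (nhds (eulerProd x)) :=
  (ModularForm.multipliable_one_sub_pow hx).hasProd.tendsto_prod_nat

lemma eulerProd_ne_zero {x : ℂ} (hx : ‖x‖ < 1) : eulerProd x ≠ 0 := by
  have := tprod_one_add_ne_zero_of_summable (f := fun n : ℕ => -x ^ (n + 1))
    (fun n => by simpa [← sub_eq_add_neg] using one_sub_pow_ne_zero hx n)
    (by simpa using (summable_nat_add_iff 1).mpr (summable_geometric_of_lt_one (norm_nonneg _) hx))
  simpa [eulerProd, sub_eq_add_neg] using this

lemma gaussProd_mul_prod {x : ℂ} (hx : ‖x‖ < 1) (n : ℕ) :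
    gaussProd x n * ∏ k ∈ Finset.range (2 * n), (1 - x ^ (k + 1)) =
      (∏ k ∈ Finset.range n, (1 - (x ^ 2) ^ (k + 1))) ^ 2 := by
  induction n with
  | zero => simp [gaussProd]
  | succ n ih =>
    rw [show 2 * (n + 1) = 2 * n + 1 + 1 by ring, Finset.prod_range_succ, Finset.prod_range_succ,
      Finset.prod_range_succ _ n, mul_pow, ← ih, gaussProd_succ]
    have h2 := one_sub_pow_ne_zero hx (2 * n)
    rw [← pow_mul, show 2 * (n + 1) = 2 * n + 1 + 1 by ring,
      show 2 * n + 2 = 2 * n + 1 + 1 by ring]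
    field_simp

lemma norm_sq_lt_one {x : ℂ} (hx : ‖x‖ < 1) : ‖x ^ 2‖ < 1 := by
  rw [norm_pow]
  exact pow_lt_one₀ (norm_nonneg _) hx (by norm_num)

lemma tendsto_gaussProd {x : ℂ} (hx : ‖x‖ < 1) :
    Filter.Tendsto (gaussProd x) Filter.atTop (nhds (eulerProd (x ^ 2) ^ 2 / eulerProd x)) := by
  have h1 := (tendsto_eulerProd (norm_sq_lt_one hx)).pow 2
  have h2 := (tendsto_eulerProd hx).comp
    (Filter.tendsto_id.const_mul_atTop' (show 0 < 2 by norm_num))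
  refine (h1.div h2 (eulerProd_ne_zero hx)).congr fun n => ?_
  simp only [Pi.div_apply, Function.comp, id]
  rw [← gaussProd_mul_prod hx, mul_div_cancel_right₀]
  exact Finset.prod_ne_zero_iff.mpr fun k _ => one_sub_pow_ne_zero hx k

/-- Gauss' identity for triangular numbers. In Shanks' finite identity the summand with `s = 0`
tends to the product, and the other summands are `O(|x|^{2n})`. -/
lemma hasSum_triangular {x : ℂ} (hx : ‖x‖ < 1) :
    HasSum (fun s : ℕ => x ^ (s * (s + 1) / 2)) (eulerProd (x ^ 2) ^ 2 / eulerProd x) := by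
  have hsum : Summable (fun s : ℕ => x ^ (s * (s + 1) / 2)) := by
    refine Summable.of_norm_bounded (summable_geometric_of_lt_one (norm_nonneg _) hx) fun s => ?_
    rw [norm_pow]
    refine pow_le_pow_of_le_one (norm_nonneg _) hx.le ?_
    rw [Nat.le_div_iff_mul_le (by norm_num)]
    rcases Nat.eq_zero_or_pos s with rfl | h <;> nlinarith
  have hne : eulerProd (x ^ 2) ^ 2 / eulerProd x ≠ 0 :=
    div_ne_zero (pow_ne_zero _ (eulerProd_ne_zero (norm_sq_lt_one hx))) (eulerProd_ne_zero hx)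
  have hlim := tendsto_gaussProd hx
  obtain ⟨C, hC⟩ : ∃ C : ℝ, ∀ n s, ‖gaussProd x n / gaussProd x s‖ ≤ C := by
    obtain ⟨C1, h1⟩ := hlim.norm.bddAbove_range
    obtain ⟨C2, h2⟩ := (hlim.inv₀ hne).norm.bddAbove_range
    refine ⟨C1 * C2, fun n s => ?_⟩
    rw [div_eq_mul_inv, norm_mul]
    have b1 : ‖gaussProd x n‖ ≤ C1 := h1 ⟨n, rfl⟩
    have b2 : ‖(gaussProd x s)⁻¹‖ ≤ C2 := h2 ⟨s, rfl⟩
    exact mul_le_mul b1 b2 (norm_nonneg _) ((norm_nonneg _).trans b1)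
  have hpart := hsum.hasSum.tendsto_sum_nat.comp
    (Filter.tendsto_id.const_mul_atTop' (show 0 < 2 by norm_num))
  have hpart2 : Filter.Tendsto (fun n : ℕ => ∑ s ∈ Finset.range (2 * n), x ^ (s * (s + 1) / 2))
      Filter.atTop (nhds (eulerProd (x ^ 2) ^ 2 / eulerProd x)) := by
    have hr : Filter.Tendsto (fun n : ℕ => C * ‖x‖ ^ (2 * n + 1) * (1 - ‖x‖)⁻¹) Filter.atTop
        (nhds 0) := by
      have := (tendsto_pow_atTop_nhds_zero_of_lt_one (norm_nonneg x) hx).comp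
        (Filter.tendsto_atTop_mono (fun n => (by omega : n ≤ 2 * n + 1)) Filter.tendsto_id)
      simpa using (this.const_mul C).mul_const (1 - ‖x‖)⁻¹
    have hdiff : Filter.Tendsto (fun n : ℕ =>
        (∑ s ∈ Finset.range (2 * n), x ^ (s * (s + 1) / 2)) - gaussProd x n) Filter.atTop
        (nhds 0) := by
      rw [tendsto_zero_iff_norm_tendsto_zero]
      refine squeeze_zero' (Filter.Eventually.of_forall fun n => norm_nonneg _) ?_ hr
      filter_upwards [Filter.eventually_ge_atTop 1] with n hn
      obtain ⟨m, rfl⟩ : ∃ m, n = m + 1 := ⟨n - 1, by omega⟩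
      rw [shanks_identity hx, Finset.sum_range_succ']
      have e0 : gaussProd x 0 = 1 := by simp [gaussProd]
      rw [zero_mul, pow_zero, mul_one, e0, div_one, add_sub_cancel_right]
      refine (norm_sum_le _ _).trans ?_
      have hb : ∀ s ∈ Finset.range m, ‖gaussProd x (m + 1) / gaussProd x (s + 1) *
          x ^ ((s + 1) * (2 * (m + 1) + 1))‖ ≤ C * ‖x‖ ^ (2 * (m + 1) + 1) * ‖x‖ ^ s := by
        intro s _
        rw [norm_mul, norm_pow, mul_assoc, ← pow_add]
        refine mul_le_mul (hC _ _) (pow_le_pow_of_le_one (norm_nonneg _) hx.le ?_)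
          (by positivity) ((norm_nonneg _).trans (hC 0 0))
        nlinarith
      refine (Finset.sum_le_sum hb).trans ?_
      rw [← Finset.mul_sum]
      refine mul_le_mul_of_nonneg_left ?_
        (mul_nonneg ((norm_nonneg _).trans (hC 0 0)) (by positivity))
      rw [← tsum_geometric_of_lt_one (norm_nonneg x) hx]
      exact (summable_geometric_of_lt_one (norm_nonneg x) hx).sum_le_tsum _
        fun _ _ => by positivity
    simpa using hdiff.add hlim
  rw [← tendsto_nhds_unique hpart hpart2]
  exact hsum.hasSum

lemma thetaOdd_eq {z : ℂ} (hz : 0 < z.im) :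
    thetaOdd z = 2 * q z * (eulerProd (q (16 * z)) ^ 2 / eulerProd (q (8 * z))) := by
  have h1 := hasSum_thetaOdd hz
  have e8 : q (8 * z) = q z ^ 8 := by exact_mod_cast q_natCast_mul 8 z
  have e16 : q (16 * z) = q (8 * z) ^ 2 := by
    rw [e8, ← pow_mul]; exact_mod_cast q_natCast_mul 16 z
  have hx : ‖q (8 * z)‖ < 1 := norm_q_lt_one ⟨8 * z, by simpa using hz⟩
  have h2 := (hasSum_triangular hx).mul_left (q z)
  rw [← e16] at h2
  have e : ∀ s : ℕ, q z * q (8 * z) ^ (s * (s + 1) / 2) = q z ^ ((2 * (s : ℤ) + 1) ^ 2) := by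
    intro s
    rw [e8, ← pow_mul, ← pow_succ', ← zpow_natCast]
    congr 1
    obtain ⟨k, hk⟩ := (Nat.even_mul_succ_self s).two_dvd
    rw [hk, Nat.mul_div_cancel_left _ (by norm_num)]
    push_cast
    have : (s : ℤ) * (s + 1) = 2 * k := by exact_mod_cast hk
    linear_combination (-4) * this
  simp only [e] at h2
  have h3 := HasSum.of_nat_of_neg_add_one (f := fun t : ℤ => q z ^ ((2 * t + 1) ^ 2)) h2
    (by convert! h2 using 1)
  rw [h1.unique h3]
  ring

lemma eta_eq (z : ℂ) : ModularForm.eta z = Function.Periodic.qParam 24 z * eulerProd (q z) := by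
  simp only [ModularForm.eta, ModularForm.eta_q, eulerProd, q_eq_qParam]

/-- `∑ q^{s²}` over odd `s` is the eta quotient `2 η(16 z)² / η(8 z)`. -/
lemma thetaOdd_mul_eta {z : ℂ} (hz : 0 < z.im) :
    thetaOdd z * ModularForm.eta (8 * z) = 2 * ModularForm.eta (16 * z) ^ 2 := by
  have hx : ‖q (8 * z)‖ < 1 := norm_q_lt_one ⟨8 * z, by simpa using hz⟩
  have h0 := eulerProd_ne_zero hx
  rw [thetaOdd_eq hz, eta_eq, eta_eq]
  have e : q z * Function.Periodic.qParam 24 (8 * z) =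
      Function.Periodic.qParam 24 (16 * z) ^ 2 := by
    rw [q, Function.Periodic.qParam, Function.Periodic.qParam, ← Complex.exp_add,
      ← Complex.exp_nat_mul]
    congr 1
    push_cast
    ring
  rw [mul_pow, ← e, mul_div_assoc', mul_comm (Function.Periodic.qParam 24 (8 * z)), ← mul_assoc,
    div_mul_cancel₀ _ h0]
  ring

lemma G₂_eq_E2 (τ : ℍ) : G₂ τ = -EisensteinSeries.E2 τ / 24 := by
  rw [EisensteinSeries.E2_eq_tsum_cexp, G₂]
  simp only [q]
  ring

/-- Multiplication of a point of the upper half plane by a positive integer. -/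
def scale (N : ℕ+) (τ : ℍ) : ℍ := ⟨(N : ℂ) * τ, by simp [τ.im_pos]⟩

@[simp] lemma coe_scale (N : ℕ+) (τ : ℍ) : (scale N τ : ℂ) = (N : ℂ) * τ := rfl

/-- The logarithmic derivative of the eta quotient. -/
lemma deriv_thetaOdd (τ : ℍ) : deriv thetaOdd τ =
    2 * Real.pi * Complex.I * (8 * G₂ (8 * τ) - 32 * G₂ (16 * τ)) * thetaOdd τ := by
  have hd := (hasSum_deriv_thetaOdd τ.im_pos).1
  have hη : ∀ N : ℕ+, HasDerivAt ModularForm.eta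
      (-(2 * Real.pi * Complex.I) * G₂ (N * τ) * ModularForm.eta (N * τ)) (N * τ) := by
    intro N
    have hN := (scale N τ).im_pos
    have h1 := ModularForm.logDeriv_eta_eq_E2 (scale N τ)
    have h2 := (ModularForm.differentiableAt_eta_of_mem_upperHalfPlaneSet hN).hasDerivAt
    have h3 : ModularForm.eta (N * τ) ≠ 0 := ModularForm.eta_ne_zero hN
    rw [coe_scale, logDeriv_apply, div_eq_iff h3] at h1
    have h4 := G₂_eq_E2 (scale N τ)
    rw [coe_scale] at h2 h4
    rw [h1] at h2
    convert! h2 using 1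
    rw [h4]
    ring
  have d8 := (hη 8).comp (τ : ℂ) ((hasDerivAt_id (τ : ℂ)).const_mul (8 : ℂ))
  have d16 := (hη 16).comp (τ : ℂ) ((hasDerivAt_id (τ : ℂ)).const_mul (16 : ℂ))
  have l := hd.mul d8
  have r := (d16.pow 2).const_mul 2
  have heq : (thetaOdd * (ModularForm.eta ∘ fun z => 8 * id z)) =ᶠ[nhds (τ : ℂ)]
      fun z => 2 * ((ModularForm.eta ∘ fun z => 16 * id z) ^ 2) z := by
    filter_upwards [isOpen_upperHalfPlaneSet.mem_nhds τ.im_pos] with z hz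
    simpa using thetaOdd_mul_eta hz
  have key := l.unique (r.congr_of_eventuallyEq heq)
  have h8 : ModularForm.eta (8 * τ) ≠ 0 :=
    ModularForm.eta_ne_zero (by simpa using τ.im_pos)
  have hmul := thetaOdd_mul_eta τ.im_pos
  simp only [Function.comp, PNat.val_ofNat, Nat.cast_ofNat] at key
  apply mul_right_cancel₀ h8
  linear_combination key + 64 * Real.pi * Complex.I * G₂ (16 * τ) * hmul

/-! ### Behaviour under `Γ₀(16)` -/

/-- Conjugation of `Γ₀(N)` by `diag(N, 1)`. -/
lemma exists_scale_smul (N : ℕ+) {γ : Matrix.SpecialLinearGroup (Fin 2) ℤ}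
    (h : (N : ℤ) ∣ γ 1 0) : ∃ δ : Matrix.SpecialLinearGroup (Fin 2) ℤ,
      N * δ 1 0 = γ 1 0 ∧ δ 1 1 = γ 1 1 ∧ (∀ τ, scale N (γ • τ) = δ • scale N τ) ∧
      ∀ τ, cocycle δ (scale N τ) = cocycle γ τ := by
  obtain ⟨e, he⟩ := h
  have hdet := γ.det_coe
  rw [Matrix.det_fin_two, he] at hdet
  let δ : Matrix.SpecialLinearGroup (Fin 2) ℤ :=
    ⟨!![γ 0 0, N * γ 0 1; e, γ 1 1], by rw [Matrix.det_fin_two_of]; linarith⟩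
  have hδ : (δ : Matrix (Fin 2) (Fin 2) ℤ) = !![γ 0 0, N * γ 0 1; e, γ 1 1] := rfl
  have hc : ∀ τ, cocycle δ (scale N τ) = cocycle γ τ := by
    intro τ
    simp [cocycle, hδ, he]
    ring
  refine ⟨δ, by simp [hδ, he], by simp [hδ], fun τ => ?_, hc⟩
  ext
  rw [coe_smul_eq, hc, coe_scale, coe_smul_eq, mul_div_assoc']
  simp [hδ]
  ring

lemma E2_smul (γ : Matrix.SpecialLinearGroup (Fin 2) ℤ) (τ : ℍ) :
    EisensteinSeries.E2 (γ • τ) = cocycle γ τ ^ 2 * EisensteinSeries.E2 τ -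
      6 * Complex.I / Real.pi * γ 1 0 * cocycle γ τ := by
  have h := congrFun (EisensteinSeries.E2_slash_action γ) τ
  have hne := cocycle_ne_zero γ τ
  have hpi : (Real.pi : ℂ) ≠ 0 := by exact_mod_cast Real.pi_ne_zero
  rw [ModularForm.SL_slash_apply] at h
  simp only [Pi.sub_apply, Pi.smul_apply, smul_eq_mul, EisensteinSeries.D2, riemannZeta_two] at h
  rw [← cocycle_eq_denom, zpow_neg, ← div_eq_mul_inv, div_eq_iff (zpow_ne_zero _ hne)] at h
  rw [h, zpow_ofNat]
  field_simp

/-- `G₂(8 z) - 2 G₂(16 z)`, a modular form of weight `2` for `Γ₀(16)`. -/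
def eisTwo (τ : ℍ) : ℂ := G₂ (8 * τ) - 2 * G₂ (16 * τ)

lemma eisTwo_eq (τ : ℍ) : eisTwo τ = -(EisensteinSeries.E2 (scale 8 τ) -
    2 * EisensteinSeries.E2 (scale 16 τ)) / 24 := by
  have h8 := G₂_eq_E2 (scale 8 τ)
  have h16 := G₂_eq_E2 (scale 16 τ)
  simp only [coe_scale, PNat.val_ofNat, Nat.cast_ofNat] at h8 h16
  rw [eisTwo, h8, h16]
  ring

/-- The non-modular terms of `E₂(8 z)` and `2 E₂(16 z)` cancel. -/
lemma eisTwo_smul {γ : Matrix.SpecialLinearGroup (Fin 2) ℤ} (h : 16 ∣ γ 1 0) (τ : ℍ) :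
    eisTwo (γ • τ) = cocycle γ τ ^ 2 * eisTwo τ := by
  obtain ⟨δ, hδ, -, hs, hc⟩ := exists_scale_smul 8 (γ := γ)
    (dvd_trans (by norm_num) h)
  obtain ⟨δ', hδ', -, hs', hc'⟩ := exists_scale_smul 16 (γ := γ) h
  have e : (δ 1 0 : ℂ) = 2 * δ' 1 0 := by
    have : δ 1 0 = 2 * δ' 1 0 := by simp at hδ hδ'; omega
    exact_mod_cast this
  rw [eisTwo_eq, hs, hs', E2_smul, E2_smul, hc, hc', eisTwo_eq, e]
  ring

lemma thetaOdd_smul {γ : Matrix.SpecialLinearGroup (Fin 2) ℤ} (h : 16 ∣ γ 1 0) (τ : ℍ) :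
    thetaOdd (γ • τ : ℍ) = factor 1 γ τ * thetaOdd τ := by
  have h4 : 4 ∣ γ 1 0 := dvd_trans (by norm_num) h
  obtain ⟨δ, hδ, hd, hs, hc⟩ := exists_scale_smul 4 (γ := γ) h4
  simp only [PNat.val_ofNat, Nat.cast_ofNat] at hδ
  have h4' : 4 ∣ δ 1 0 := by omega
  have e1 := thetaLaw_of_four_dvd h4' (scale 4 τ)
  have e2 : factor 1 δ (scale 4 τ) = factor 1 γ τ := by
    rw [factor_one, factor_one, hc, hd, ← hδ, kronecker_four_mul _ (odd_of_four_dvd h4)]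
  rw [← hs, e2] at e1
  simp only [coe_scale, PNat.val_ofNat, Nat.cast_ofNat] at e1
  rw [thetaOdd, thetaOdd, e1, thetaLaw_of_four_dvd h4, mul_sub]

/-! ### Growth at the cusps -/

lemma smul_eq_of_S_of_T {X : Type*} {φ : ℍ → X} (hS : ∀ τ, φ (ModularGroup.S • τ) = φ τ)
    (hT : ∀ τ, φ (ModularGroup.T • τ) = φ τ) (γ : Matrix.SpecialLinearGroup (Fin 2) ℤ) (τ : ℍ) :
    φ (γ • τ) = φ τ := by
  have hγ : γ ∈ Subgroup.closure {ModularGroup.S, ModularGroup.T} := by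
    simp [SpecialLinearGroup.SL2Z_generators]
  induction hγ using Subgroup.closure_induction generalizing τ with
  | one => rw [one_smul]
  | mem g hg =>
    rcases hg with rfl | rfl
    · exact hS τ
    · exact hT τ
  | mul g g' _ _ h1 h2 => rw [mul_smul, h1, h2]
  | inv g _ h1 => rw [← h1, smul_inv_smul]

/-- A matrix of determinant `N` is upper triangular up to left multiplication by `SL(2, ℤ)`. Here
this is applied to `diag(N, 1) ξ`, and the upper triangular matrix acts by `τ ↦ A τ + B`. -/
lemma exists_scale_smul_eq (N : ℕ+) (ξ : Matrix.SpecialLinearGroup (Fin 2) ℤ) :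
    ∃ (δ : Matrix.SpecialLinearGroup (Fin 2) ℤ) (A B : ℝ) (w : ℍ → ℍ), 0 < A ∧
      (∀ τ, (w τ : ℂ) = A * τ + B) ∧ ∀ τ, scale N (ξ • τ) = δ • w τ := by
  have hdet := ξ.det_coe
  rw [Matrix.det_fin_two] at hdet
  set a := ξ 0 0
  set b := ξ 0 1
  set c := ξ 1 0
  set d := ξ 1 1
  have hg0 : Int.gcd (N * a) c ≠ 0 := by
    intro h
    obtain ⟨h1, h2⟩ := Int.gcd_eq_zero_iff.mp h
    have : a = 0 := by simpa using h1
    rw [h2, this] at hdet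
    simp at hdet
  obtain ⟨p, hp⟩ := Int.gcd_dvd_left (a := N * a) (b := c)
  obtain ⟨r, hr⟩ := Int.gcd_dvd_right (a := N * a) (b := c)
  have hbez := Int.gcd_eq_gcd_ab (N * a) c
  set u := Int.gcdA (N * a) c
  set v := Int.gcdB (N * a) c
  set g : ℤ := (Int.gcd (N * a) c : ℤ) with hg
  have hgpos : 0 < g := by rw [hg]; exact_mod_cast Nat.pos_of_ne_zero hg0
  have hdetδ : p * u - (-v) * r = 1 := by
    apply mul_left_cancel₀ hgpos.ne'
    linear_combination (-u) * hp - v * hr - hbez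
  have hNpos : (0 : ℝ) < N := by exact_mod_cast N.pos
  have hgR : (0 : ℝ) < g := by exact_mod_cast hgpos
  -- the lower right entry of the upper triangular matrix is `D = N / g`
  have hD : g * (p * d - r * (N * b)) = N := by
    linear_combination (-d) * hp + N * b * hr + N * hdet
  have hDpos : (0 : ℤ) < p * d - r * (N * b) := by
    have h0 : (0 : ℤ) < N := by exact_mod_cast N.pos
    rw [← hD] at h0
    exact pos_of_mul_pos_right h0 hgpos.le
  have hDR : (0 : ℝ) < ((p * d - r * (N * b) : ℤ) : ℝ) := by exact_mod_cast hDpos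
  set D : ℤ := p * d - r * (N * b) with hDdef
  let w : ℍ → ℍ := fun τ => ⟨((g / D : ℝ) : ℂ) * τ + (((u * (N * b) + v * d : ℤ) / D : ℝ) : ℂ), by
    rw [Complex.add_im, Complex.im_ofReal_mul, Complex.ofReal_im, add_zero]
    exact mul_pos (div_pos hgR hDR) τ.im_pos⟩
  have hw : ∀ τ, (w τ : ℂ) = ((g / D : ℝ) : ℂ) * τ + (((u * (N * b) + v * d : ℤ) / D : ℝ) : ℂ) :=
    fun τ => rfl
  obtain ⟨δ, hδ'⟩ : ∃ δ : Matrix.SpecialLinearGroup (Fin 2) ℤ,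
      (δ : Matrix (Fin 2) (Fin 2) ℤ) = !![p, -v; r, u] :=
    ⟨⟨!![p, -v; r, u], by rw [Matrix.det_fin_two_of]; exact hdetδ⟩, rfl⟩
  refine ⟨δ, g / D, (u * (N * b) + v * d : ℤ) / D, w, div_pos hgR hDR, hw, fun τ => ?_⟩
  ext
  have h1 := cocycle_ne_zero ξ τ
  have h2 := cocycle_ne_zero δ (w τ)
  rw [coe_smul_eq, coe_scale, coe_smul_eq, mul_div_assoc', div_eq_div_iff h1 h2]
  have hDC : (D : ℂ) ≠ 0 := by exact_mod_cast hDpos.ne'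
  have hpC : (N : ℂ) * a = g * p := by exact_mod_cast hp
  have hrC : (c : ℂ) = g * r := by exact_mod_cast hr
  have hdC : (p : ℂ) * u - (-v) * r = 1 := by exact_mod_cast hdetδ
  have hDC' : (D : ℂ) = p * d - r * (N * b) := by rw [hDdef]; push_cast; ring
  simp only [cocycle, hδ', hw, Matrix.of_apply, Matrix.cons_val', Matrix.cons_val_zero,
    Matrix.cons_val_one, Matrix.cons_val_fin_one]
  push_cast
  have e1 : (r : ℂ) * (g / D * τ + (u * (N * b) + v * d) / D) + u = (c * τ + d) / D := by
    field_simp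
    rw [hDC', hrC]
    linear_combination (d : ℂ) * hdC
  have e2 : (p : ℂ) * (g / D * τ + (u * (N * b) + v * d) / D) + -v = N * (a * τ + b) / D := by
    field_simp
    rw [hDC']
    linear_combination (N : ℂ) * b * hdC - (τ : ℂ) * hpC
  rw [e1, e2]
  ring

/-- If `u · Im ^ k` is `SL(2, ℤ)`-invariant and `u` is bounded at `i∞`, then `τ ↦ u (N τ)` is
bounded at all cusps as a function of weight `2 k`. -/
lemma isBigO_of_invariant {u : ℍ → ℝ} {k : ℝ}
    (hu : ∀ (γ : Matrix.SpecialLinearGroup (Fin 2) ℤ) τ,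
      u (γ • τ) * (γ • τ).im ^ k = u τ * τ.im ^ k)
    (hb : u =O[atImInfty] fun _ => (1 : ℝ)) (N : ℕ+)
    (ξ : Matrix.SpecialLinearGroup (Fin 2) ℤ) :
    (fun τ => ‖cocycle ξ τ‖ ^ (-(2 * k)) * u (scale N (ξ • τ))) =O[atImInfty]
      fun _ => (1 : ℝ) := by
  obtain ⟨δ, A, B, w, hA, hw, hδ⟩ := exists_scale_smul_eq N ξ
  have hwim : ∀ τ, (w τ).im = A * τ.im := fun τ => by
    rw [← coe_im, hw]; simp
  have hNpos : (0 : ℝ) < N := by exact_mod_cast N.pos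
  have heq : ∀ τ, ‖cocycle ξ τ‖ ^ (-(2 * k)) * u (scale N (ξ • τ)) =
      (A / N) ^ k * u (w τ) := by
    intro τ
    have h1 := hu δ (w τ)
    have hc : 0 < ‖cocycle ξ τ‖ := norm_pos_iff.mpr (cocycle_ne_zero _ _)
    have him : (scale N (ξ • τ)).im = N * τ.im * ‖cocycle ξ τ‖ ^ (-2 : ℝ) := by
      have : (scale N (ξ • τ)).im = N * (ξ • τ).im := by
        rw [← coe_im, coe_scale]; simp
      rw [this, im_smul_eq, Real.rpow_neg hc.le]
      norm_cast
      ring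
    rw [← hδ, him, hwim, Real.mul_rpow (by positivity) (by positivity),
      Real.mul_rpow hA.le τ.im_pos.le, Real.mul_rpow hNpos.le τ.im_pos.le, ← Real.rpow_mul hc.le]
      at h1
    rw [Real.div_rpow hA.le hNpos.le, show -(2 * k) = -2 * k by ring]
    have p1 : 0 < τ.im ^ k := Real.rpow_pos_of_pos τ.im_pos _
    have p2 : 0 < (N : ℝ) ^ k := Real.rpow_pos_of_pos hNpos _
    rw [div_mul_eq_mul_div, eq_div_iff p2.ne']
    apply mul_right_cancel₀ p1.ne'
    linear_combination h1
  simp only [heq]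
  have htend : Filter.Tendsto w atImInfty atImInfty := by
    rw [atImInfty, Filter.tendsto_comap_iff]
    have : im ∘ w = fun τ => A * τ.im := funext hwim
    rw [this]
    exact Filter.tendsto_comap.const_mul_atTop hA
  exact (hb.comp_tendsto htend).const_mul_left _

/-- The norm of the non-holomorphic modular form `E₂ - 3 / (π Im)` of weight `2`. -/
def normE2Star (τ : ℍ) : ℝ := ‖EisensteinSeries.E2 τ - 3 / (Real.pi * τ.im)‖

lemma normE2Star_invariant (γ : Matrix.SpecialLinearGroup (Fin 2) ℤ) (τ : ℍ) :
    normE2Star (γ • τ) * (γ • τ).im ^ (1 : ℝ) = normE2Star τ * τ.im ^ (1 : ℝ) := by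
  have hne := cocycle_ne_zero γ τ
  have hy : (τ.im : ℂ) ≠ 0 := by exact_mod_cast τ.im_pos.ne'
  have hpi : (Real.pi : ℂ) ≠ 0 := by exact_mod_cast Real.pi_ne_zero
  have hn : ((‖cocycle γ τ‖ ^ 2 : ℝ) : ℂ) =
      cocycle γ τ * (cocycle γ τ - 2 * Complex.I * γ 1 0 * τ.im) := by
    have : (starRingEnd ℂ) (cocycle γ τ) = cocycle γ τ - 2 * Complex.I * γ 1 0 * τ.im := by
      apply Complex.ext
      · simp [cocycle]
      · simp [cocycle]; ring
    rw [← this, Complex.mul_conj, Complex.normSq_eq_norm_sq]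
  have key : EisensteinSeries.E2 (γ • τ) - 3 / (Real.pi * (γ • τ).im) =
      cocycle γ τ ^ 2 * (EisensteinSeries.E2 τ - 3 / (Real.pi * τ.im)) := by
    rw [im_smul_eq, E2_smul, Complex.ofReal_div, hn]
    have hne2 : cocycle γ τ - 2 * Complex.I * γ 1 0 * τ.im ≠ 0 := by
      intro h0
      rw [h0, mul_zero] at hn
      exact hne (by simpa using hn)
    field_simp
    ring
  have hpos : 0 < ‖cocycle γ τ‖ := norm_pos_iff.mpr hne
  rw [Real.rpow_one, Real.rpow_one, normE2Star, key, im_smul_eq, norm_mul, norm_pow, normE2Star]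
  field_simp

lemma normE2Star_isBigO : normE2Star =O[atImInfty] fun _ => (1 : ℝ) := by
  have h1 : EisensteinSeries.E2 =O[atImInfty] fun _ => (1 : ℝ) :=
    EisensteinSeries.isBoundedAtImInfty_E2
  have h2 : (fun τ : ℍ => (3 / (Real.pi * τ.im) : ℂ)) =O[atImInfty] fun _ => (1 : ℝ) := by
    apply Asymptotics.IsBigO.of_bound (3 / Real.pi)
    have : ∀ᶠ τ : ℍ in atImInfty, 1 ≤ τ.im :=
      Filter.tendsto_comap.eventually (Filter.eventually_ge_atTop 1)
    filter_upwards [this] with τ hτ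
    have hpi := Real.pi_pos
    rw [norm_div, norm_mul, Complex.norm_real, Complex.norm_real, Real.norm_of_nonneg hpi.le,
      Real.norm_of_nonneg τ.im_pos.le]
    simp only [Complex.norm_ofNat, norm_one, mul_one]
    apply div_le_div_of_nonneg_left (by norm_num) hpi
    nlinarith
  exact (h1.sub h2).norm_left

lemma jacobiTheta₂_add_one (z τ : ℂ) : jacobiTheta₂ z (τ + 1) = jacobiTheta₂ (z + 1 / 2) τ := by
  refine tsum_congr fun n => ?_
  rw [jacobiTheta₂_term, jacobiTheta₂_term, Complex.exp_eq_exp_iff_exists_int]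
  obtain ⟨k, hk⟩ := (Int.even_mul_succ_self (n - 1)).two_dvd
  refine ⟨k, ?_⟩
  have : ((n : ℂ) - 1) * (n - 1 + 1) = 2 * k := by exact_mod_cast hk
  linear_combination Real.pi * Complex.I * this

/-- The theta null value `∑ exp (π i (n + 1/2)² τ)`. -/
def thetaHalf (τ : ℂ) : ℂ := Complex.exp (Real.pi * Complex.I * τ / 4) * jacobiTheta₂ (τ / 2) τ

/-- The sum of the absolute values of the three even theta null values. -/
def normTheta (τ : ℍ) : ℝ :=
  ‖thetaHalf τ‖ + ‖jacobiTheta₂ 0 τ‖ + ‖jacobiTheta₂ (1 / 2) τ‖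

/-- `SL(2, ℤ)` permutes the three even theta null values up to factors of absolute value
`|c τ + d| ^ (1/2)`. -/
lemma normTheta_invariant (γ : Matrix.SpecialLinearGroup (Fin 2) ℤ) (τ : ℍ) :
    normTheta (γ • τ) * (γ • τ).im ^ (1 / 4 : ℝ) = normTheta τ * τ.im ^ (1 / 4 : ℝ) := by
  refine smul_eq_of_S_of_T (φ := fun τ => normTheta τ * τ.im ^ (1 / 4 : ℝ)) ?_ ?_ γ τ
  · intro τ
    have hτ := ne_zero τ
    have hS : ((ModularGroup.S • τ : ℍ) : ℂ) = -1 / τ := by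
      rw [modular_S_smul]
      simp [neg_div]
    have hc : cocycle ModularGroup.S τ = τ := by simp [cocycle, ModularGroup.S]
    have hpos : 0 < ‖(τ : ℂ)‖ := norm_pos_iff.mpr hτ
    have hw : ‖(-Complex.I * (τ : ℂ)) ^ (1 / 2 : ℂ)‖ = ‖(τ : ℂ)‖ ^ (1 / 2 : ℝ) := by
      have := Complex.norm_cpow_real (-Complex.I * (τ : ℂ)) (1 / 2)
      push_cast at this
      rw [this]
      simp
    have hw0 : 0 < ‖(τ : ℂ)‖ ^ (1 / 2 : ℝ) := Real.rpow_pos_of_pos hpos _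
    have f0 := congrArg norm (jacobiTheta₂_functional_equation 0 τ)
    have f1 := congrArg norm (jacobiTheta₂_functional_equation (1 / 2) τ)
    have f2 := congrArg norm (jacobiTheta₂_functional_equation (τ / 2) τ)
    -- `S` fixes the first of the three null values below and exchanges the other two
    have g0 : ‖jacobiTheta₂ 0 τ‖ = (‖(τ : ℂ)‖ ^ (1 / 2 : ℝ))⁻¹ * ‖jacobiTheta₂ 0 (-1 / τ)‖ := by
      rw [f0, norm_mul, norm_mul, norm_div, hw]
      simp
    have g1 : ‖jacobiTheta₂ (1 / 2) τ‖ = (‖(τ : ℂ)‖ ^ (1 / 2 : ℝ))⁻¹ * ‖thetaHalf (-1 / τ)‖ := by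
      rw [f1, norm_mul, norm_mul, norm_div, hw, norm_one, one_div, thetaHalf, norm_mul, mul_assoc,
        ← jacobiTheta₂_neg_left]
      have e1 : -Real.pi * Complex.I * (1 / 2) ^ 2 / (τ : ℂ) =
          Real.pi * Complex.I * (-1 / τ) / 4 := by
        field_simp
        norm_num
      have e2 : -(1 / 2 / (τ : ℂ)) = -1 / τ / 2 := by
        field_simp
      rw [e1, e2]
    have g2 : ‖thetaHalf τ‖ = (‖(τ : ℂ)‖ ^ (1 / 2 : ℝ))⁻¹ * ‖jacobiTheta₂ (1 / 2) (-1 / τ)‖ := by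
      have e : Complex.exp (Real.pi * Complex.I * τ / 4) *
          Complex.exp (-Real.pi * Complex.I * (τ / 2) ^ 2 / τ) = 1 := by
        rw [← Complex.exp_add, Complex.exp_eq_one_iff]
        refine ⟨0, ?_⟩
        field_simp
        norm_num
      have e2 : (τ : ℂ) / 2 / τ = 1 / 2 := by field_simp
      have e' := congrArg norm e
      rw [norm_mul, norm_one] at e'
      rw [thetaHalf, norm_mul, f2, norm_mul, norm_mul, norm_div, hw, norm_one, one_div, e2]
      linear_combination (‖(τ : ℂ)‖ ^ (1 / 2 : ℝ))⁻¹ * ‖jacobiTheta₂ (1 / 2) (-1 / τ)‖ * e'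
    have hsum : normTheta (ModularGroup.S • τ) = ‖(τ : ℂ)‖ ^ (1 / 2 : ℝ) * normTheta τ := by
      rw [normTheta, normTheta, hS, g0, g1, g2]
      field_simp
      ring
    have him : (ModularGroup.S • τ).im ^ (1 / 4 : ℝ) =
        τ.im ^ (1 / 4 : ℝ) * (‖(τ : ℂ)‖ ^ (1 / 2 : ℝ))⁻¹ := by
      rw [im_smul_eq, hc, Real.div_rpow τ.im_pos.le (by positivity), ← Real.rpow_natCast,
        ← Real.rpow_mul hpos.le, div_eq_mul_inv]
      norm_num
    rw [hsum, him]
    field_simp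
  · intro τ
    have hT : ((ModularGroup.T • τ : ℍ) : ℂ) = τ + 1 := by
      rw [modular_T_smul, coe_vadd, add_comm]
      simp
    have him : (ModularGroup.T • τ).im = τ.im := by
      rw [← coe_im, hT]; simp
    have h2 : ‖thetaHalf (τ + 1)‖ = ‖thetaHalf τ‖ := by
      have e1 : ((τ : ℂ) + 1) / 2 + 1 / 2 = τ / 2 + 1 := by ring
      have e2 : Complex.exp (Real.pi * Complex.I * (τ + 1) / 4) =
          Complex.exp (Real.pi * Complex.I * τ / 4) *
            Complex.exp ((Real.pi / 4 : ℝ) * Complex.I) := by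
        rw [← Complex.exp_add]
        congr 1
        push_cast
        ring
      rw [thetaHalf, thetaHalf, jacobiTheta₂_add_one, e1, jacobiTheta₂_add_left, e2, norm_mul,
        norm_mul, norm_mul, Complex.norm_exp_ofReal_mul_I, mul_one]
    have h3 : jacobiTheta₂ (1 / 2) (τ + 1) = jacobiTheta₂ 0 τ := by
      rw [jacobiTheta₂_add_one, show (1 / 2 + 1 / 2 : ℂ) = 0 + 1 by norm_num, jacobiTheta₂_add_left]
    simp only [normTheta, hT, him, h2, h3, jacobiTheta₂_add_one 0, zero_add]
    ring

lemma thetaOdd_eq_thetaHalf {z : ℂ} (hz : 0 < z.im) : thetaOdd z = thetaHalf (8 * z) := by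
  have h := (hasSum_jacobiTheta₂_term (8 * z / 2) (τ := 8 * z) (by simpa using hz)).mul_left
    (Complex.exp (Real.pi * Complex.I * (8 * z) / 4))
  refine (hasSum_thetaOdd hz).unique ?_
  convert! h using 1
  ext t
  rw [jacobiTheta₂_term, ← Complex.exp_add, q, ← Complex.exp_int_mul]
  congr 1
  push_cast
  ring

lemma normTheta_isBigO : normTheta =O[atImInfty] fun _ => (1 : ℝ) := by
  have hJ : jacobiTheta =O[Filter.comap Complex.im Filter.atTop] fun _ => (1 : ℝ) := by
    have h1 : (fun τ : ℂ => Real.exp (-Real.pi * τ.im)) =O[Filter.comap Complex.im Filter.atTop]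
        fun _ => (1 : ℝ) := by
      apply Asymptotics.IsBigO.of_bound 1
      have : ∀ᶠ τ : ℂ in Filter.comap Complex.im Filter.atTop, 0 ≤ τ.im :=
        Filter.tendsto_comap.eventually (Filter.eventually_ge_atTop 0)
      filter_upwards [this] with τ hτ
      rw [Real.norm_of_nonneg (Real.exp_pos _).le, norm_one, mul_one, Real.exp_le_one_iff]
      nlinarith [Real.pi_pos]
    have h2 := isBigO_at_im_infty_jacobiTheta_sub_one.trans h1
    have h3 : (fun _ : ℂ => (1 : ℂ)) =O[Filter.comap Complex.im Filter.atTop] fun _ => (1 : ℝ) :=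
      Asymptotics.isBigO_const_const _ one_ne_zero _
    simpa using h2.add h3
  have hcomp : ∀ (a : ℝ) (b : ℂ), 0 < a → b.im = 0 →
      (fun τ : ℍ => jacobiTheta (a * τ + b)) =O[atImInfty] fun _ => (1 : ℝ) := by
    intro a b ha hb
    refine hJ.comp_tendsto (k := fun τ : ℍ => (a * τ + b : ℂ)) ?_
    rw [Filter.tendsto_comap_iff]
    have : Complex.im ∘ (fun τ : ℍ => (a * τ + b : ℂ)) = fun τ : ℍ => a * τ.im := by
      ext τ; simp [hb]
    rw [this]
    exact Filter.tendsto_comap.const_mul_atTop ha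
  have i3 : (fun τ : ℍ => jacobiTheta₂ 0 τ) =O[atImInfty] fun _ => (1 : ℝ) := by
    simpa [← jacobiTheta_eq_jacobiTheta₂] using hcomp 1 0 one_pos rfl
  have i4 : (fun τ : ℍ => jacobiTheta₂ (1 / 2) τ) =O[atImInfty] fun _ => (1 : ℝ) := by
    have := hcomp 1 1 one_pos rfl
    simp only [jacobiTheta_eq_jacobiTheta₂, Complex.ofReal_one, one_mul, jacobiTheta₂_add_one,
      zero_add] at this
    exact this
  have i2 : (fun τ : ℍ => thetaHalf τ) =O[atImInfty] fun _ => (1 : ℝ) := by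
    have e : ∀ τ : ℍ, thetaHalf τ =
        jacobiTheta ((1 / 4 : ℝ) * τ + 0) - jacobiTheta ((1 : ℝ) * τ + 0) := by
      intro τ
      have h := thetaOdd_eq_thetaHalf (z := τ / 8) (by simpa using τ.im_pos)
      rw [show 8 * ((τ : ℂ) / 8) = τ by ring, thetaOdd, theta_eq_jacobiTheta,
        theta_eq_jacobiTheta] at h
      rw [← h]
      congr 2 <;> push_cast <;> ring
    simp only [e]
    exact (hcomp _ 0 (by norm_num) rfl).sub (hcomp 1 0 one_pos rfl)
  exact (i2.norm_left.add i3.norm_left).add i4.norm_left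

/-- The form `(G₂(8 z) - 2 G₂(16 z)) ∑ q^{s²}`, the sum over odd `s`. -/
def eisTheta (τ : ℍ) : ℂ := eisTwo τ * thetaOdd τ

lemma eisTheta_isBoundedAtImInfty (ξ : Matrix.SpecialLinearGroup (Fin 2) ℤ) :
    IsBoundedAtImInfty fun τ : ℍ => cocycle ξ τ ^ (-(((5 : ℤ) : ℂ) / 2)) * eisTheta (ξ • τ) := by
  have b8 := isBigO_of_invariant normE2Star_invariant normE2Star_isBigO 8 ξ
  have b16 := isBigO_of_invariant normE2Star_invariant normE2Star_isBigO 16 ξ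
  have bt := isBigO_of_invariant normTheta_invariant normTheta_isBigO 8 ξ
  have hF : ∀ τ : ℍ, ‖eisTwo τ‖ ≤ normE2Star (scale 8 τ) + 2 * normE2Star (scale 16 τ) := by
    intro τ
    -- the multiples of `1 / Im` cancel, so `E₂` may be replaced by `E₂ - 3 / (π Im)`
    have e : eisTwo τ = -(1 / 24) * ((EisensteinSeries.E2 (scale 8 τ) -
        3 / (Real.pi * (scale 8 τ).im)) - 2 * (EisensteinSeries.E2 (scale 16 τ) -
        3 / (Real.pi * (scale 16 τ).im))) := by
      have i8 : (scale 8 τ).im = 8 * τ.im := by rw [← coe_im, coe_scale]; simp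
      have i16 : (scale 16 τ).im = 16 * τ.im := by rw [← coe_im, coe_scale]; simp
      have hy : (τ.im : ℂ) ≠ 0 := by exact_mod_cast τ.im_pos.ne'
      have hpi : (Real.pi : ℂ) ≠ 0 := by exact_mod_cast Real.pi_ne_zero
      rw [eisTwo_eq, i8, i16]
      push_cast
      field_simp
      ring
    rw [e, norm_mul]
    have h2 := norm_sub_le (EisensteinSeries.E2 (scale 8 τ) - 3 / (Real.pi * (scale 8 τ).im))
      (2 * (EisensteinSeries.E2 (scale 16 τ) - 3 / (Real.pi * (scale 16 τ).im)))
    rw [norm_mul] at h2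
    simp only [normE2Star]
    have h3 : ‖(-(1 / 24) : ℂ)‖ ≤ 1 := by norm_num
    have h4 : ‖(2 : ℂ)‖ = 2 := by norm_num
    rw [h4] at h2
    exact (mul_le_of_le_one_left (norm_nonneg _) h3).trans h2
  have hT : ∀ τ : ℍ, ‖thetaOdd τ‖ ≤ normTheta (scale 8 τ) := by
    intro τ
    rw [thetaOdd_eq_thetaHalf τ.im_pos, normTheta]
    simp only [coe_scale, PNat.val_ofNat, Nat.cast_ofNat]
    have := norm_nonneg (jacobiTheta₂ 0 (8 * τ))
    have := norm_nonneg (jacobiTheta₂ (1 / 2) (8 * τ))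
    linarith
  have hall := (b8.add (b16.const_mul_left 2)).mul bt
  rw [one_mul] at hall
  refine Asymptotics.IsBigO.trans (Asymptotics.IsBigO.of_bound 1
    (Filter.Eventually.of_forall fun τ => ?_)) hall
  have hc : 0 < ‖cocycle ξ τ‖ := norm_pos_iff.mpr (cocycle_ne_zero _ _)
  have hn : ‖cocycle ξ τ ^ (-(((5 : ℤ) : ℂ) / 2))‖ =
      ‖cocycle ξ τ‖ ^ (-(2 * 1) : ℝ) * ‖cocycle ξ τ‖ ^ (-(2 * (1 / 4)) : ℝ) := by
    have := Complex.norm_cpow_real (cocycle ξ τ) (-(5 / 2))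
    push_cast at this ⊢
    rw [this, ← Real.rpow_add hc]
    norm_num
  rw [norm_mul, hn, eisTheta, norm_mul, one_mul]
  refine le_trans ?_ (le_abs_self _)
  set x := ‖cocycle ξ τ‖ ^ (-(2 * 1) : ℝ)
  set y := ‖cocycle ξ τ‖ ^ (-(2 * (1 / 4)) : ℝ)
  have hx : 0 ≤ x := by positivity
  have hy : 0 ≤ y := by positivity
  have h1 := mul_le_mul_of_nonneg_left (hF (ξ • τ)) hx
  have h2 := mul_le_mul_of_nonneg_left (hT (ξ • τ)) hy
  calc x * y * (‖eisTwo (ξ • τ)‖ * ‖thetaOdd (ξ • τ : ℍ)‖)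
      = (x * ‖eisTwo (ξ • τ)‖) * (y * ‖thetaOdd (ξ • τ : ℍ)‖) := by ring
    _ ≤ (x * (normE2Star (scale 8 (ξ • τ)) + 2 * normE2Star (scale 16 (ξ • τ)))) *
        (y * normTheta (scale 8 (ξ • τ))) :=
      mul_le_mul h1 h2 (by positivity) ((by positivity : 0 ≤ x * ‖eisTwo (ξ • τ)‖).trans h1)
    _ = _ := by ring

lemma E2_comp_scale_mdifferentiable (N : ℕ+) :
    MDifferentiable (modelWithCornersSelf ℂ ℂ) (modelWithCornersSelf ℂ ℂ)
      fun τ : ℍ => EisensteinSeries.E2 (scale N τ) := by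
  rw [UpperHalfPlane.mdifferentiable_iff]
  have h := UpperHalfPlane.mdifferentiable_iff.mp E2_mdifferentiable
  have hN : (0 : ℝ) < N := by exact_mod_cast N.pos
  have hmap : Set.MapsTo (fun z : ℂ => (N : ℂ) * z) upperHalfPlaneSet upperHalfPlaneSet := by
    intro z hz
    have hz' : 0 < z.im := hz
    show 0 < ((N : ℂ) * z).im
    simpa using hz'
  refine (h.comp ((differentiable_id.const_mul (N : ℂ)).differentiableOn) hmap).congr ?_
  intro z hz
  have hz' : 0 < z.im := hz
  simp only [Function.comp]
  congr 1
  ext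
  rw [coe_scale, ofComplex_apply_of_im_pos hz', ofComplex_apply_of_im_pos (hmap hz)]

lemma thetaOdd_mdifferentiable :
    MDifferentiable (modelWithCornersSelf ℂ ℂ) (modelWithCornersSelf ℂ ℂ)
      fun τ : ℍ => thetaOdd τ := by
  rw [UpperHalfPlane.mdifferentiable_iff]
  have h : DifferentiableOn ℂ thetaOdd upperHalfPlaneSet := fun z hz =>
    (hasSum_deriv_thetaOdd hz).1.differentiableAt.differentiableWithinAt
  refine h.congr fun z hz => ?_
  simp only [Function.comp]
  rw [ofComplex_apply_of_im_pos hz]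

theorem eisTheta_mem : eisTheta ∈ modularForms 5 64 := by
  refine ⟨?_, fun γ hγ τ => ?_, eisTheta_isBoundedAtImInfty⟩
  · have e : eisTheta = (fun τ => (-(1 / 24) : ℂ)) * ((fun τ => EisensteinSeries.E2 (scale 8 τ)) -
        (fun τ => (2 : ℂ)) * fun τ => EisensteinSeries.E2 (scale 16 τ)) *
        (fun τ : ℍ => thetaOdd τ) := by
      ext τ
      simp only [eisTheta, eisTwo_eq, Pi.mul_apply, Pi.sub_apply]
      ring
    rw [e]
    exact (mdifferentiable_const.mul ((E2_comp_scale_mdifferentiable 8).sub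
      (mdifferentiable_const.mul (E2_comp_scale_mdifferentiable 16)))).mul thetaOdd_mdifferentiable
  · have h64 : (64 : ℤ) ∣ γ 1 0 :=
      (ZMod.intCast_zmod_eq_zero_iff_dvd _ 64).mp (CongruenceSubgroup.Gamma0_mem.mp hγ)
    have h16 : (16 : ℤ) ∣ γ 1 0 := dvd_trans (by norm_num) h64
    rw [eisTheta, eisTheta, eisTwo_smul h16, thetaOdd_smul h16,
      factor_five (dvd_trans (by norm_num) h64)]
    ring

/-! ### Fourier coefficients -/

/-- Collecting the terms of equal exponent in a sum of powers of `q`. -/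
lemma hasSum_fiber {ι : Type*} {w : ι → ℂ} {e : ι → ℕ} {τ : ℍ} {A : ℂ}
    (H : HasSum (fun i => w i * q τ ^ e i) A) :
    HasSum (fun n : ℕ => (∑' i : {i // e i = n}, w i) * q τ ^ n) A := by
  have h1 := (Equiv.sigmaFiberEquiv e).hasSum_iff.mpr H
  have h2 := h1.sigma fun n => (h1.summable.sigma_factor n).hasSum
  convert! h2 using 1
  ext n
  rw [← tsum_mul_right]
  refine tsum_congr fun i => ?_
  simp [Equiv.sigmaFiberEquiv, i.2]

lemma tsum_fiber_ite {ι : Type*} (w : ι → ℂ) (e : ι → ℕ) (P : ℕ → Prop) [DecidablePred P] (n : ℕ) :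
    ∑' i : {i // e i = n}, (if P (e i) then w i else 0) =
      if P n then ∑' i : {i // e i = n}, w i else 0 := by
  have : ∀ i : {i // e i = n}, (if P (e i) then w i else 0) = if P n then w i else 0 := by
    rintro ⟨i, rfl⟩; rfl
  simp only [this]
  split_ifs <;> simp

/-- The coefficients of `G₂`. -/
def eisCoeff (k : ℕ) : ℂ := if k = 0 then -1 / 24 else ArithmeticFunction.sigma 1 k

lemma hasSum_G₂ (τ : ℍ) : HasSum (fun k => eisCoeff k * q τ ^ k) (G₂ τ) := by
  have h := (EisensteinSeries.hasSum_qExpansion_E2 (z := τ)).mul_left (-1 / 24)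
  rw [G₂_eq_E2]
  convert! h using 1
  · ext k
    simp only [eisCoeff, q, smul_eq_mul]
    split_ifs <;> ring
  · ring

lemma hasSum_G₂_natCast_mul {m : ℕ} (hm : 0 < m) (τ : ℍ) :
    HasSum (fun k => eisCoeff k * q τ ^ (m * k)) (G₂ (m * τ)) := by
  obtain ⟨N, rfl⟩ : ∃ N : ℕ+, (N : ℕ) = m := ⟨⟨m, hm⟩, rfl⟩
  have h := hasSum_G₂ (scale N τ)
  simp only [coe_scale, q_natCast_mul, ← pow_mul] at h
  exact h

lemma sigma_two_mul {n : ℕ} (hn : n ≠ 0) : ArithmeticFunction.sigma 1 (2 * n) +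
    2 * (if Even n then ArithmeticFunction.sigma 1 (n / 2) else 0) =
    3 * ArithmeticFunction.sigma 1 n := by
  obtain ⟨k, u, hu, rfl⟩ := Nat.exists_eq_two_pow_mul_odd hn
  have hcop : ∀ j, Nat.Coprime (2 ^ j) u := fun j =>
    Nat.Coprime.pow_left _ (Nat.coprime_two_left.mpr hu)
  have hpow : ∀ j, ArithmeticFunction.sigma 1 (2 ^ j) + 1 = 2 ^ (j + 1) := by
    intro j
    rw [ArithmeticFunction.sigma_one_apply_prime_pow Nat.prime_two, Nat.geomSum_eq le_rfl]
    simp [Nat.sub_add_cancel Nat.one_le_two_pow]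
  have hmul : ∀ j, ArithmeticFunction.sigma 1 (2 ^ j * u) =
      ArithmeticFunction.sigma 1 (2 ^ j) * ArithmeticFunction.sigma 1 u := fun j =>
    ArithmeticFunction.isMultiplicative_sigma.map_mul_of_coprime (hcop j)
  rw [← mul_assoc, ← pow_succ', hmul, hmul]
  rcases Nat.eq_zero_or_pos k with rfl | hk
  · have h0 := hpow 0
    have h1 := hpow 1
    rw [if_neg (by simpa using hu), show ArithmeticFunction.sigma 1 (2 ^ 0) = 1 by omega,
      show ArithmeticFunction.sigma 1 (2 ^ (0 + 1)) = 3 by simp at h1 ⊢; omega]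
    ring
  · obtain ⟨j, rfl⟩ : ∃ j, k = j + 1 := ⟨k - 1, by omega⟩
    have e : 2 ^ (j + 1) * u / 2 = 2 ^ j * u := by
      rw [pow_succ', mul_assoc, Nat.mul_div_cancel_left _ (by norm_num)]
    rw [if_pos (by simp [pow_succ]), e, hmul]
    have h0 := hpow j
    have h1 := hpow (j + 1)
    have h2 := hpow (j + 1 + 1)
    have : ArithmeticFunction.sigma 1 (2 ^ (j + 1 + 1)) + 2 * ArithmeticFunction.sigma 1 (2 ^ j) =
        3 * ArithmeticFunction.sigma 1 (2 ^ (j + 1)) := by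
      generalize ArithmeticFunction.sigma 1 (2 ^ (j + 1 + 1)) = x2 at *
      generalize ArithmeticFunction.sigma 1 (2 ^ (j + 1)) = x1 at *
      generalize ArithmeticFunction.sigma 1 (2 ^ j) = x0 at *
      simp only [pow_succ] at h0 h1 h2
      omega
    rw [← mul_assoc 3, ← this]
    ring

lemma eisCoeff_two_mul (n : ℕ) :
    eisCoeff (2 * n) = 3 * eisCoeff n - 2 * (if Even n then eisCoeff (n / 2) else 0) := by
  rcases eq_or_ne n 0 with rfl | hn
  · simp [eisCoeff]; norm_num
  have h := sigma_two_mul hn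
  have h' : ((ArithmeticFunction.sigma 1 (2 * n) + 2 * (if Even n then
    ArithmeticFunction.sigma 1 (n / 2) else 0) : ℕ) : ℂ) = 3 * ArithmeticFunction.sigma 1 n := by
    rw [h]; push_cast; ring
  push_cast at h'
  have h2 : Even n → n / 2 ≠ 0 := by rintro ⟨k, hk⟩; omega
  simp only [eisCoeff, hn, mul_eq_zero, OfNat.ofNat_ne_zero, or_self, if_false]
  split_ifs with he h0
  · exact absurd h0 (h2 he)
  · simp only [he, if_true] at h'
    linear_combination h'
  · simp only [he, if_false] at h'
    linear_combination h'

lemma hasSum_even {u : ℕ → ℂ} {A : ℂ} (h : HasSum (fun j => u (2 * j)) A) :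
    HasSum (fun k => if Even k then u k else 0) A := by
  have inj : Function.Injective (fun j : ℕ => 2 * j) := fun x y h => by simpa using h
  rw [← inj.hasSum_iff]
  · simpa [Function.comp_def] using h
  · intro x hx
    rw [if_neg]
    rintro ⟨y, rfl⟩
    exact hx ⟨y, by ring⟩

/-- The even part of `G₂(4 z)`, from `σ₁(2 n) = 3 σ₁(n) - 2 σ₁(n / 2)`. -/
lemma hasSum_G₂_even (τ : ℍ) :
    HasSum (fun k => (if Even k then eisCoeff k else 0) * q τ ^ (4 * k))
      (3 * G₂ (8 * τ) - 2 * G₂ (16 * τ)) := by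
  have h8 := (hasSum_G₂_natCast_mul (m := 8) (by norm_num) τ).mul_left 3
  have h16 : HasSum (fun j => if Even j then eisCoeff (j / 2) * q τ ^ (8 * j) else 0)
      (G₂ ((16 : ℕ) * τ)) := by
    apply hasSum_even (u := fun j => eisCoeff (j / 2) * q τ ^ (8 * j))
    convert! hasSum_G₂_natCast_mul (m := 16) (by norm_num) τ using 1
    ext j
    rw [Nat.mul_div_cancel_left _ (by norm_num), ← mul_assoc]
    norm_num
  have h := h8.sub (h16.mul_left 2)
  push_cast at h
  have h2 : HasSum (fun j => eisCoeff (2 * j) * q τ ^ (4 * (2 * j)))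
      (3 * G₂ (8 * τ) - 2 * G₂ (16 * τ)) := by
    convert! h using 1
    ext j
    rw [eisCoeff_two_mul, ← mul_assoc]
    norm_num
    split_ifs <;> ring
  convert! hasSum_even (u := fun k => eisCoeff k * q τ ^ (4 * k)) h2 using 1
  ext k
  split_ifs <;> simp

/-- The coefficient attached to the pair `(k, s)` in the product expansion of
`A θ + (1 / m) D θ`, where `A` has coefficients `u` and the theta series has coefficients `c`. -/
def pairCoeff (m : ℕ) (u : ℕ → ℂ) (c : ℤ → ℂ) (p : ℕ × ℤ) : ℂ :=
  u p.1 * c p.2 + if p.1 = 0 then (p.2 : ℂ) ^ 2 * c p.2 / m else 0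

/-- The exponent `m k + s²` attached to the pair `(k, s)`. -/
def pairExp (m : ℕ) (p : ℕ × ℤ) : ℕ := m * p.1 + p.2.natAbs ^ 2

lemma hasSum_pair {m : ℕ} {u : ℕ → ℂ} {c : ℤ → ℂ} {τ : ℍ} {A B D : ℂ}
    (hA : HasSum (fun k => u k * q τ ^ (m * k)) A)
    (hB : HasSum (fun s : ℤ => c s * q τ ^ (s ^ 2)) B)
    (hD : HasSum (fun s : ℤ => (s : ℂ) ^ 2 * c s * q τ ^ (s ^ 2)) D) :
    HasSum (fun p => pairCoeff m u c p * q τ ^ pairExp m p) (A * B + D / m) := by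
  have hq : ∀ s : ℤ, q τ ^ (s ^ 2) = q τ ^ (s.natAbs ^ 2) := by
    intro s
    rw [← zpow_natCast]
    congr 1
    push_cast
    exact (sq_abs s).symm
  simp only [hq] at hB hD
  have hs : Summable fun p : ℕ × ℤ =>
      (u p.1 * q τ ^ (m * p.1)) * (c p.2 * q τ ^ (p.2.natAbs ^ 2)) :=
    summable_mul_of_summable_norm (f := fun k => u k * q τ ^ (m * k))
      (g := fun s : ℤ => c s * q τ ^ (s.natAbs ^ 2)) hA.summable.norm hB.summable.norm
  have h1 := hA.mul hB hs
  have inj : Function.Injective (fun s : ℤ => ((0 : ℕ), s)) := fun x y h => by simpa using h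
  have h2 : HasSum (fun p : ℕ × ℤ => if p.1 = 0 then
      (p.2 : ℂ) ^ 2 * c p.2 / m * q τ ^ (p.2.natAbs ^ 2) else 0) (D / m) := by
    rw [← inj.hasSum_iff]
    · have e : ∀ s : ℤ, (s : ℂ) ^ 2 * c s / m * q τ ^ (s.natAbs ^ 2) =
          (s : ℂ) ^ 2 * c s * q τ ^ (s.natAbs ^ 2) / m := fun s => by ring
      simpa only [Function.comp_def, if_true, e] using hD.div_const (m : ℂ)
    · rintro ⟨k, s⟩ hx
      rw [if_neg]
      intro hk
      exact hx ⟨s, by simp only at hk; rw [hk]⟩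
  have e : (fun p => pairCoeff m u c p * q τ ^ pairExp m p) = fun p : ℕ × ℤ =>
      (u p.1 * q τ ^ (m * p.1)) * (c p.2 * q τ ^ (p.2.natAbs ^ 2)) + if p.1 = 0 then
      (p.2 : ℂ) ^ 2 * c p.2 / m * q τ ^ (p.2.natAbs ^ 2) else 0 := by
    funext p
    simp only [pairCoeff, pairExp, pow_add]
    split_ifs with hk
    · rw [hk, mul_zero, pow_zero]
      ring
    · ring
  rw [e]
  exact h1.add h2

lemma hasSum_f {m : ℕ} (hm : 0 < m) (τ : ℍ) :
    HasSum (fun p => pairCoeff m eisCoeff (fun _ => 1) p * q τ ^ pairExp m p) (f m τ) := by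
  have hpi : (Real.pi : ℂ) ≠ 0 := by exact_mod_cast Real.pi_ne_zero
  have hI := Complex.I_ne_zero
  have hD := (hasSum_deriv_theta τ.im_pos).2.div_const (2 * Real.pi * Complex.I)
  have hB := hasSum_theta τ.im_pos
  have h := hasSum_pair (c := fun _ => 1) (hasSum_G₂_natCast_mul hm τ) (by simpa using hB)
    (D := deriv θ τ / (2 * Real.pi * Complex.I)) (by
      convert! hD using 1
      ext s
      field_simp)
  convert! h using 1
  have : (m : ℂ) ≠ 0 := by exact_mod_cast hm.ne'
  rw [f]
  field_simp

/-- The `n`-th coefficient of `f_m`, as a sum over the pairs `(k, s)` with `m k + s² = n`. -/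
def fCoeff (m n : ℕ) : ℂ := ∑' p : {p // pairExp m p = n}, pairCoeff m eisCoeff (fun _ => 1) p

lemma hasSum_fCoeff {m : ℕ} (hm : 0 < m) (τ : ℍ) :
    HasSum (fun n => fCoeff m n * q τ ^ n) (f m τ) :=
  hasSum_fiber (hasSum_f hm τ)

lemma periodic_of_hasSum {F : ℍ → ℂ} {b : ℕ → ℂ}
    (h : ∀ τ : ℍ, HasSum (fun n => b n * q τ ^ n) (F τ)) :
    Function.Periodic (F ∘ ofComplex) (1 : ℝ) := by
  intro z
  by_cases hz : 0 < z.im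
  · have hz1 : 0 < (z + (1 : ℝ)).im := by simpa using hz
    simp only [Function.comp, ofComplex_apply_of_im_pos hz, ofComplex_apply_of_im_pos hz1]
    refine (h _).unique ?_
    convert! h ⟨z, hz⟩ using 4
    have := q_add_intCast z 1
    simpa using this
  · have hz1 : (z + (1 : ℝ)).im ≤ 0 := by simpa using hz
    simp only [Function.comp, ofComplex_apply_of_im_nonpos (not_lt.mp hz),
      ofComplex_apply_of_im_nonpos hz1]

/-- The coefficients of a convergent expansion in powers of `q` are those of `qExpansion`. -/
lemma coeff_eq_of_hasSum {F : ℍ → ℂ} {b : ℕ → ℂ}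
    (hF : MDifferentiable (modelWithCornersSelf ℂ ℂ) (modelWithCornersSelf ℂ ℂ) F)
    (h : ∀ τ : ℍ, HasSum (fun n => b n * q τ ^ n) (F τ)) (n : ℕ) :
    (qExpansion 1 F).coeff n = b n := by
  have h' : ∀ τ : ℍ, HasSum (fun n => b n • Function.Periodic.qParam 1 τ ^ n) (F τ) := by
    intro τ
    simpa only [q_eq_qParam, smul_eq_mul] using h τ
  have hb := isBoundedAtImInfty_of_hasSum_qExpansion one_pos h'
  let : FunLike (ℍ → ℂ) ℍ ℂ := ⟨fun F => F, fun _ _ h => h⟩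
  exact (qExpansion_coeff_unique F one_pos
    (analyticAt_cuspFunction_zero one_pos (periodic_of_hasSum h) hF hb) h' n).symm

lemma f_mdifferentiable {m : ℕ} (hm : 0 < m) :
    MDifferentiable (modelWithCornersSelf ℂ ℂ) (modelWithCornersSelf ℂ ℂ) (f m) := by
  obtain ⟨N, rfl⟩ : ∃ N : ℕ+, (N : ℕ) = m := ⟨⟨m, hm⟩, rfl⟩
  rw [UpperHalfPlane.mdifferentiable_iff]
  have hE := UpperHalfPlane.mdifferentiable_iff.mp (E2_comp_scale_mdifferentiable N)
  have hθ : DifferentiableOn ℂ θ upperHalfPlaneSet := fun z hz =>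
    (hasSum_deriv_theta hz).1.differentiableAt.differentiableWithinAt
  have h := ((hE.const_mul (-1 / 24)).mul hθ).add
    ((hθ.deriv isOpen_upperHalfPlaneSet).const_mul (1 / (2 * N * Real.pi * Complex.I)))
  refine h.congr fun z hz => ?_
  have hG := G₂_eq_E2 (scale N ⟨z, hz⟩)
  simp only [coe_scale] at hG
  simp only [Function.comp, ofComplex_apply_of_im_pos (show 0 < z.im from hz), f, hG, Pi.add_apply,
    Pi.mul_apply]
  ring

lemma a_eq_fCoeff {m : ℕ} (hm : 0 < m) (n : ℕ) : a m n = fCoeff m n :=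
  coeff_eq_of_hasSum (f_mdifferentiable hm) (hasSum_fCoeff hm) n

/-! ### The two forms -/

lemma hasSum_odd_int {u : ℤ → ℂ} {A : ℂ} (h : HasSum (fun t => u (2 * t + 1)) A) :
    HasSum (fun s => if Odd s then u s else 0) A := by
  have inj : Function.Injective (fun t : ℤ => 2 * t + 1) := fun x y h => by simpa using h
  rw [← inj.hasSum_iff]
  · simpa [Function.comp_def] using h
  · intro x hx
    rw [if_neg]
    rintro ⟨y, rfl⟩
    exact hx ⟨y, rfl⟩

/-- The pair expansion over odd `s` of `A ∑ q^{s²} + (1 / m) ∑ s² q^{s²}`, with the derivative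
evaluated by `deriv_thetaOdd`. -/
lemma hasSum_pair_odd {m : ℕ} {u : ℕ → ℂ} {τ : ℍ} {A : ℂ}
    (hA : HasSum (fun k => u k * q τ ^ (m * k)) A) :
    HasSum (fun p => pairCoeff m u (fun s => if Odd s then 1 else 0) p * q τ ^ pairExp m p)
      ((A + (8 * G₂ (8 * τ) - 32 * G₂ (16 * τ)) / m) * thetaOdd τ) := by
  have hpi : (Real.pi : ℂ) ≠ 0 := by exact_mod_cast Real.pi_ne_zero
  have hI := Complex.I_ne_zero
  have hD := (hasSum_deriv_thetaOdd τ.im_pos).2.div_const (2 * Real.pi * Complex.I)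
  rw [deriv_thetaOdd] at hD
  have hB := hasSum_odd_int (u := fun s : ℤ => q τ ^ (s ^ 2)) (hasSum_thetaOdd τ.im_pos)
  have hD' := hasSum_odd_int (u := fun s : ℤ => (s : ℂ) ^ 2 * q τ ^ (s ^ 2))
    (A := (8 * G₂ (8 * τ) - 32 * G₂ (16 * τ)) * thetaOdd τ) (by
      convert! hD using 1
      · ext s
        field_simp
      · field_simp)
  have h := hasSum_pair (m := m) (c := fun s => if Odd s then 1 else 0) hA
    (by simpa [ite_mul] using hB) (by
      convert! hD' using 1
      ext s
      split_ifs <;> simp)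
  convert! h using 1
  ring

lemma natAbs_sq_mod_eight (s : ℤ) : (Odd s ∧ s.natAbs ^ 2 % 8 = 1) ∨
    (¬ Odd s ∧ (s.natAbs ^ 2 % 8 = 0 ∨ s.natAbs ^ 2 % 8 = 4)) := by
  have h : s.natAbs % 8 < 8 := Nat.mod_lt _ (by norm_num)
  rw [← Int.natAbs_odd, Nat.odd_iff, Nat.pow_mod]
  have h2 : s.natAbs % 2 = s.natAbs % 8 % 2 := by omega
  rw [h2]
  generalize s.natAbs % 8 = x at *
  interval_cases x <;> simp

/-- An exponent `8 k + s²` is `1` modulo `8` exactly for odd `s`. -/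
lemma pairCoeff_eight (p : ℕ × ℤ) : pairCoeff 8 eisCoeff (fun s => if Odd s then 1 else 0) p =
    if pairExp 8 p ≡ 1 [MOD 8] then pairCoeff 8 eisCoeff (fun _ => 1) p else 0 := by
  obtain ⟨k, s⟩ := p
  simp only [pairExp, pairCoeff, Nat.ModEq]
  rcases natAbs_sq_mod_eight s with ⟨h1, h2⟩ | ⟨h1, h2⟩
  · have h3 : (8 * k + s.natAbs ^ 2) % 8 = 1 % 8 := by omega
    simp only [h1, h3, if_true]
  · have h3 : ¬ (8 * k + s.natAbs ^ 2) % 8 = 1 % 8 := by omega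
    simp only [h1, h3, if_false]
    simp

/-- An exponent `4 k + s²` is `1` modulo `8` exactly for even `k` and odd `s`. -/
lemma pairCoeff_four (p : ℕ × ℤ) : pairCoeff 4 (fun k => if Even k then eisCoeff k else 0)
    (fun s => if Odd s then 1 else 0) p =
    if pairExp 4 p ≡ 1 [MOD 8] then pairCoeff 4 eisCoeff (fun _ => 1) p else 0 := by
  obtain ⟨k, s⟩ := p
  simp only [pairExp, pairCoeff, Nat.ModEq]
  rcases natAbs_sq_mod_eight s with ⟨h1, h2⟩ | ⟨h1, h2⟩
  · by_cases hk : Even k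
    · have h3 : (4 * k + s.natAbs ^ 2) % 8 = 1 % 8 := by obtain ⟨j, rfl⟩ := hk; omega
      simp only [h1, h3, hk, if_true]
    · have hk0 : k ≠ 0 := by rintro rfl; simp at hk
      have h3 : ¬ (4 * k + s.natAbs ^ 2) % 8 = 1 % 8 := by
        obtain ⟨j, rfl⟩ := Nat.not_even_iff_odd.mp hk
        omega
      simp only [hk, h3, hk0, if_false]
      ring
  · have h3 : ¬ (4 * k + s.natAbs ^ 2) % 8 = 1 % 8 := by omega
    simp only [h1, h3, if_false]
    simp

lemma hasSum_mod_eight {m : ℕ} (hm : 0 < m) {u : ℕ → ℂ}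
    (hu : ∀ p, pairCoeff m u (fun s => if Odd s then 1 else 0) p =
      if pairExp m p ≡ 1 [MOD 8] then pairCoeff m eisCoeff (fun _ => 1) p else 0)
    {τ : ℍ} {A : ℂ} (hA : HasSum (fun k => u k * q τ ^ (m * k)) A) :
    HasSum (fun n : {n : ℕ // n ≡ 1 [MOD 8]} => a m n * q τ ^ (n : ℕ))
      ((A + (8 * G₂ (8 * τ) - 32 * G₂ (16 * τ)) / m) * thetaOdd τ) := by
  have h := hasSum_fiber (hasSum_pair_odd hA)
  simp only [hu] at h
  simp only [tsum_fiber_ite (pairCoeff m eisCoeff fun _ => 1) (pairExp m) (· ≡ 1 [MOD 8])] at h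
  rw [show (fun n : {n : ℕ // n ≡ 1 [MOD 8]} => a m n * q τ ^ (n : ℕ)) =
    (fun n : ℕ => a m n * q τ ^ n) ∘ Subtype.val from rfl]
  refine (hasSum_subtype_iff_indicator (s := {n | n ≡ 1 [MOD 8]})).mpr ?_
  convert! h using 1
  ext n
  rw [Set.indicator_apply, a_eq_fCoeff hm]
  simp only [Set.mem_ofPred_eq, fCoeff]
  split_ifs <;> simp

lemma hasSum_h (τ : ℍ) :
    HasSum (fun n : {n : ℕ // n ≡ 1 [MOD 8]} => a 8 n * q τ ^ (n : ℕ)) (2 * eisTheta τ) := by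
  have h := hasSum_mod_eight (by norm_num) pairCoeff_eight
    (hasSum_G₂_natCast_mul (m := 8) (by norm_num) τ)
  convert! h using 1
  rw [eisTheta, eisTwo]
  push_cast
  ring

lemma hasSum_g (τ : ℍ) :
    HasSum (fun n : {n : ℕ // n ≡ 1 [MOD 8]} => a 4 n * q τ ^ (n : ℕ)) (5 * eisTheta τ) := by
  have h := hasSum_mod_eight (by norm_num) pairCoeff_four (hasSum_G₂_even τ)
  convert! h using 1
  rw [eisTheta, eisTwo]
  push_cast
  ring

lemma h_eq : h = (2 : ℂ) • eisTheta := funext fun τ => (hasSum_h τ).tsum_eq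

lemma g_eq : g = (5 : ℂ) • eisTheta := funext fun τ => (hasSum_g τ).tsum_eq

lemma a_eight_eq {n : ℕ} (hn : n ≡ 1 [MOD 8]) : a 8 n = 2 / 5 * a 4 n := by
  have hz : ∀ τ : ℍ, HasSum (fun n => ({n | n ≡ 1 [MOD 8]} : Set ℕ).indicator
      (fun n => a 8 n - 2 / 5 * a 4 n) n * q τ ^ n) ((fun _ => 0 : ℍ → ℂ) τ) := by
    intro τ
    have h := (hasSum_h τ).sub ((hasSum_g τ).mul_left (2 / 5))
    rw [show 2 * eisTheta τ - 2 / 5 * (5 * eisTheta τ) = 0 by ring] at h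
    have h' := (hasSum_subtype_iff_indicator (s := {n | n ≡ 1 [MOD 8]})
      (f := fun n => (a 8 n - 2 / 5 * a 4 n) * q τ ^ n)).mp (by
        convert! h using 1
        ext n
        simp only [Function.comp]
        ring)
    convert! h' using 1
    ext n
    simp only [Set.indicator_apply]
    split_ifs <;> simp
  have h := coeff_eq_of_hasSum mdifferentiable_const hz n
  change (qExpansion 1 (0 : ℍ → ℂ)).coeff n = _ at h
  rw [qExpansion_zero, map_zero, Set.indicator_of_mem (show n ∈ {n | n ≡ 1 [MOD 8]} from hn)] at h
  exact (sub_eq_zero.mp h.symm)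

end HalfIntegralWeight

end

theorem proposition2p8 :
    (∀ τ : UpperHalfPlane, HasSum
      (fun n : ℕ => HalfIntegralWeight.a 4 n * HalfIntegralWeight.q τ ^ n)
      (HalfIntegralWeight.f 4 τ)) ∧
    (∀ τ : UpperHalfPlane, HasSum
      (fun n : ℕ => HalfIntegralWeight.a 8 n * HalfIntegralWeight.q τ ^ n)
      (HalfIntegralWeight.f 8 τ)) ∧
    HalfIntegralWeight.g ∈ HalfIntegralWeight.modularForms 5 64 ∧
    HalfIntegralWeight.h ∈ HalfIntegralWeight.modularForms 5 64 ∧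
    HalfIntegralWeight.h = (2 / 5 : ℂ) • HalfIntegralWeight.g ∧
    ∀ n : ℕ, n ≡ 1 [MOD 8] →
      HalfIntegralWeight.a 8 n = 2 / 5 * HalfIntegralWeight.a 4 n := by
  refine ⟨fun τ => ?_, fun τ => ?_, ?_, ?_, ?_, fun n hn => HalfIntegralWeight.a_eight_eq hn⟩
  · simpa only [HalfIntegralWeight.a_eq_fCoeff (show 0 < 4 by norm_num)]
      using HalfIntegralWeight.hasSum_fCoeff (by norm_num) τ
  · simpa only [HalfIntegralWeight.a_eq_fCoeff (show 0 < 8 by norm_num)]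
      using HalfIntegralWeight.hasSum_fCoeff (by norm_num) τ
  · rw [HalfIntegralWeight.g_eq]
    exact Submodule.smul_mem _ _ HalfIntegralWeight.eisTheta_mem
  · rw [HalfIntegralWeight.h_eq]
    exact Submodule.smul_mem _ _ HalfIntegralWeight.eisTheta_mem
  · rw [HalfIntegralWeight.h_eq, HalfIntegralWeight.g_eq, smul_smul]
    norm_num
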